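/- Let $N\ge 3$. For $u\in C_c^2(\mathbb{R}^N)$ (real-valued) put $$\|u\|_{2-\frac2N,N}:=\|u\|_{W^{1,N}(\mathbb{R}^N)}+\left(\int_{\mathbb{R}^N}\int_{\mathbb{R}^N}\frac{|Du(x)-Du(y)|^N}{|x-y|^{N+\sigma N}}\,dx\,dy\right)^{1/N},\qquad \sigma=1-\frac2N,$$ where $\|u\|_{W^{1,N}}=\|u\|_{L^N}+\|Du\|_{L^N}$. Then there is a constant $C>0$, depending only on $N$, such that for all $u_1,u_2,\varphi\in C_c^2(\mathbb{R}^N)$ $$\left|\int_{\mathbb{R}^N}\big(\det(D^2u_1)-\det(D^2u_2)\big)\varphi\,dx\right|\le C\,\|u_1-u_2\|_{2-\frac2N,N}\left(\|u_1\|_{2-\frac2N,N}^{N-1}+\|u_2\|_{2-\frac2N,N}^{N-1}\right)\|D^2\varphi\|_{L^\infty(\mathbb{R}^N)}.$$ -/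

import Mathlib

open MeasureTheory
open scoped ENNReal

/-- The Hessian matrix `D²u(x)`, with `(i, j)` entry `∂ᵢ∂ⱼu(x)`. -/
noncomputable def hessianMatrix {N : ℕ} (u : EuclideanSpace ℝ (Fin N) → ℝ)
    (x : EuclideanSpace ℝ (Fin N)) : Matrix (Fin N) (Fin N) ℝ :=
  Matrix.of fun i j =>
    fderiv ℝ (fderiv ℝ u) x (EuclideanSpace.single i 1) (EuclideanSpace.single j 1)

/-- The `W^{1,p}` norm `‖u‖_{L^p} + ‖Du‖_{L^p}` of a `C¹` function (possibly infinite).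
The operator norm of `fderiv ℝ u x` is the Euclidean length of the gradient. -/
noncomputable def sobolevENorm {N : ℕ} (p : ℝ) (u : EuclideanSpace ℝ (Fin N) → ℝ) : ℝ≥0∞ :=
  eLpNorm u (ENNReal.ofReal p) volume + eLpNorm (fderiv ℝ u) (ENNReal.ofReal p) volume

/-- The Gagliardo seminorm of order `σ` and exponent `p` of the derivative `Du`
(possibly infinite). -/
noncomputable def gagliardoESeminormDeriv {N : ℕ} (σ p : ℝ)
    (u : EuclideanSpace ℝ (Fin N) → ℝ) : ℝ≥0∞ :=
  (∫⁻ x : EuclideanSpace ℝ (Fin N), ∫⁻ y : EuclideanSpace ℝ (Fin N),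
    ENNReal.ofReal (‖fderiv ℝ u x - fderiv ℝ u y‖ ^ p / ‖x - y‖ ^ ((N : ℝ) + σ * p))) ^ (1 / p)

/-- The norm of `B(s,p)`, `1 < s < 2`, `1 ≤ p < ∞`, on `C¹` functions (possibly infinite):
the `W^{1,p}` norm plus the Gagliardo seminorm of `Du` of order `σ = s - 1`. -/
noncomputable def besovENorm {N : ℕ} (s p : ℝ) (u : EuclideanSpace ℝ (Fin N) → ℝ) : ℝ≥0∞ :=
  sobolevENorm p u + gagliardoESeminormDeriv (s - 1) p u

/-- The `B(s,p)` norm as a real number, for functions of finite norm. -/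
noncomputable def besovNorm {N : ℕ} (s p : ℝ) (u : EuclideanSpace ℝ (Fin N) → ℝ) : ℝ :=
  (besovENorm s p u).toReal

/-- `‖D²φ‖_{L^∞}`, with `D²φ(x)` measured by its norm as a bilinear form. -/
noncomputable def hessianSupNorm {N : ℕ} (φ : EuclideanSpace ℝ (Fin N) → ℝ) : ℝ :=
  (eLpNorm (fderiv ℝ (fderiv ℝ φ)) ∞ volume).toReal

/-!
Let `u_t` be the mollification of `u` at scale `t`. Then `∫ det(D²u_t) φ` tends to `∫ det(D²u) φ`
as `t → 0` and to `0` as `t → ∞`. Since the cofactor matrix of a Hessian is divergence free, two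
integrations by parts move both derivatives of `∂_t u_t` onto `φ`:
`d/dt ∫ det(D²u_t) φ = ∫ ∂_t u_t · tr(adj(D²u_t) D²φ)`.
Both `|∂_t u_t|` and `t |D²u_t|` are bounded at `x` by the mean oscillation of `Du` over the ball
`B(x, t)`. By multilinearity the difference of the fluxes of `u₁` and `u₂` is therefore at most
`C t^{1-N} osc(u₁ - u₂) (osc u₁ + osc u₂)^{N-1} ‖D²φ‖_∞`. Hölder's inequality with respect to
`t^{1-N} dt dx`, followed by Jensen's inequality, leaves `∫∫ t^{1-N} ⨍ |Du(x) - Du(y)|^N dy dx dt`,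
and integrating in `t` over `t > |x - y|` produces the Gagliardo seminorm, because
`1 - N = -1 - σN`.
-/

section Determinant

open Matrix

variable {n : Type*} [Fintype n] [DecidableEq n]
variable {E : Type*} [NormedAddCommGroup E] [NormedSpace ℝ E]

/-- The determinant as a continuous multilinear map of the rows; its operator norm (for the sup
norm on rows) is the only constant needed to estimate determinants and cofactors. -/
noncomputable def detRowCMM (n : Type*) [Fintype n] [DecidableEq n] :
    ContinuousMultilinearMap ℝ (fun _ : n => n → ℝ) ℝ where
  toMultilinearMap := detRowAlternating.toMultilinearMap
  cont := continuous_id.matrix_det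

theorem abs_det_sub_det_le {A B : Matrix n n ℝ} {M δ : ℝ} (hM : 0 ≤ M) (hδ : 0 ≤ δ)
    (hA : ∀ i j, |A i j| ≤ M) (hB : ∀ i j, |B i j| ≤ M) (hAB : ∀ i j, |A i j - B i j| ≤ δ) :
    |A.det - B.det| ≤ ‖detRowCMM n‖ * Fintype.card n * M ^ (Fintype.card n - 1) * δ := by
  have norm_le {D : n → n → ℝ} {K : ℝ} (hK : 0 ≤ K) (hD : ∀ i j, |D i j| ≤ K) : ‖D‖ ≤ K :=
    (pi_norm_le_iff_of_nonneg hK).2 fun i => (pi_norm_le_iff_of_nonneg hK).2 (hD i)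
  refine ((detRowCMM n).norm_image_sub_le (fun i j => A i j) (fun i j => B i j)).trans ?_
  gcongr
  · exact max_le (norm_le hM hA) (norm_le hM hB)
  · exact norm_le hδ hAB

theorem det_updateRow_eq_sum_adjugate_mul (A : Matrix n n ℝ) (i : n) (b : n → ℝ) :
    (A.updateRow i b).det = ∑ j, A.adjugate j i * b j := by
  rw [← cramer_transpose_apply, cramer_eq_adjugate_mulVec, ← adjugate_transpose]
  rfl

theorem mul_adjugate_eq_det_updateRow (a : ℝ) (A : Matrix n n ℝ) (i j : n) :
    a * A.adjugate i j = (A.updateRow j (Pi.single i a)).det := by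
  rw [det_updateRow_eq_sum_adjugate_mul]
  simp [Pi.single_apply, mul_comm]

theorem abs_mul_adjugate_sub_mul_adjugate_le {A B : Matrix n n ℝ} {a b M δ : ℝ}
    (ha : |a| ≤ M) (hb : |b| ≤ M) (hab : |a - b| ≤ δ) (hA : ∀ i j, |A i j| ≤ M)
    (hB : ∀ i j, |B i j| ≤ M) (hAB : ∀ i j, |A i j - B i j| ≤ δ) (i j : n) :
    |a * A.adjugate i j - b * B.adjugate i j| ≤
      ‖detRowCMM n‖ * Fintype.card n * M ^ (Fintype.card n - 1) * δ := by
  have hM : 0 ≤ M := (abs_nonneg a).trans ha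
  have hδ : 0 ≤ δ := (abs_nonneg _).trans hab
  rw [mul_adjugate_eq_det_updateRow, mul_adjugate_eq_det_updateRow]
  refine abs_det_sub_det_le hM hδ (fun k l => ?_) (fun k l => ?_) fun k l => ?_ <;>
    simp only [updateRow_apply, Pi.single_apply] <;> split_ifs <;> simp_all

theorem abs_mul_trace_adjugate_mul_sub_le {A B P : Matrix n n ℝ} {a b M δ H : ℝ}
    (ha : |a| ≤ M) (hb : |b| ≤ M) (hab : |a - b| ≤ δ) (hA : ∀ i j, |A i j| ≤ M)
    (hB : ∀ i j, |B i j| ≤ M) (hAB : ∀ i j, |A i j - B i j| ≤ δ) (hP : ∀ i j, |P i j| ≤ H) :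
    |a * (A.adjugate * P).trace - b * (B.adjugate * P).trace| ≤
      Fintype.card n ^ 2 *
        (‖detRowCMM n‖ * Fintype.card n * M ^ (Fintype.card n - 1) * δ * H) := by
  have hexpand : a * (A.adjugate * P).trace - b * (B.adjugate * P).trace =
      ∑ i, ∑ j, (a * A.adjugate i j - b * B.adjugate i j) * P j i := by
    simp only [trace, diag_apply, mul_apply, Finset.mul_sum, ← Finset.sum_sub_distrib, sub_mul,
      mul_assoc]
  have hterm (i j : n) : |(a * A.adjugate i j - b * B.adjugate i j) * P j i| ≤
      ‖detRowCMM n‖ * Fintype.card n * M ^ (Fintype.card n - 1) * δ * H := by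
    have h := abs_mul_adjugate_sub_mul_adjugate_le ha hb hab hA hB hAB i j
    rw [abs_mul]
    exact mul_le_mul h (hP j i) (abs_nonneg _) ((abs_nonneg _).trans h)
  rw [hexpand, ← Real.norm_eq_abs]
  refine (norm_sum_le_of_le _ fun i _ => norm_sum_le_of_le _ fun j _ => hterm i j).trans_eq ?_
  simp only [Finset.sum_const, Finset.card_univ, nsmul_eq_mul]
  ring

theorem hasFDerivAt_det {A : E → Matrix n n ℝ} {A' : n → n → E →L[ℝ] ℝ} {x : E}
    (hA : ∀ i j, HasFDerivAt (fun y => A y i j) (A' i j) x) :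
    HasFDerivAt (fun y => (A y).det) (∑ i, ∑ j, (A x).adjugate j i • A' i j) x := by
  have hrows : HasFDerivAt (fun y i j => A y i j)
      (ContinuousLinearMap.pi fun i => ContinuousLinearMap.pi (A' i)) x :=
    hasFDerivAt_pi.2 fun i => hasFDerivAt_pi.2 (hA i)
  refine (((detRowCMM n).hasFDerivAt fun i j => A x i j).comp x hrows).congr_fderiv ?_
  ext v
  simp only [ContinuousLinearMap.comp_apply, ContinuousMultilinearMap.linearDeriv_apply,
    _root_.sum_apply, _root_.smul_apply, smul_eq_mul]
  exact Finset.sum_congr rfl fun i _ => det_updateRow_eq_sum_adjugate_mul (A x) i _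

theorem hasDerivAt_det {A : ℝ → Matrix n n ℝ} {A' : Matrix n n ℝ} {t : ℝ}
    (hA : ∀ i j, HasDerivAt (fun s => A s i j) (A' i j) t) :
    HasDerivAt (fun s => (A s).det) (trace ((A t).adjugate * A')) t := by
  refine (hasFDerivAt_det fun i j => (hA i j).hasFDerivAt).hasDerivAt.congr_deriv ?_
  rw [trace_mul_comm]
  simp [trace, mul_apply, mul_comm]

theorem contDiffOn_det {A : E → Matrix n n ℝ} {k : WithTop ℕ∞} {s : Set E}
    (hA : ∀ i j, ContDiffOn ℝ k (fun y => A y i j) s) : ContDiffOn ℝ k (fun y => (A y).det) s :=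
  (detRowCMM n).contDiff.comp_contDiffOn (contDiffOn_pi.2 fun i => contDiffOn_pi.2 (hA i))

theorem contDiffOn_adjugate {A : E → Matrix n n ℝ} {k : WithTop ℕ∞} {s : Set E}
    (hA : ∀ i j, ContDiffOn ℝ k (fun y => A y i j) s) (i j : n) :
    ContDiffOn ℝ k (fun y => (A y).adjugate i j) s := by
  simp only [adjugate_apply]
  refine contDiffOn_det fun l m => ?_
  simp only [updateRow_apply]
  split_ifs
  exacts [contDiffOn_const, hA l m]

theorem adjugate_updateRow_single_antisymm (A : Matrix n n ℝ) {i l : n} (hil : l ≠ i) (j m : n) :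
    (A.updateRow i (Pi.single j 1)).adjugate m l =
      -(A.updateRow i (Pi.single m 1)).adjugate j l := by
  have hswap : (A.updateRow i (Pi.single j 1)).updateRow l (Pi.single m 1) =
      ((A.updateRow i (Pi.single m 1)).updateRow l (Pi.single j 1)).submatrix
        (Equiv.swap l i) id := by
    ext k q
    rcases eq_or_ne k i with rfl | hki
    · simp [updateRow_apply, hil.symm]
    rcases eq_or_ne k l with rfl | hkl
    · simp [updateRow_apply, hil.symm]
    · simp [updateRow_apply, hki, hkl, Equiv.swap_apply_of_ne_of_ne hkl hki]
  rw [adjugate_apply, adjugate_apply, hswap, det_permute, Equiv.Perm.sign_swap hil]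
  simp

theorem sum_mul_eq_zero_of_antisymm_of_symm {ι : Type*} [Fintype ι] {S T : ι → ι → ℝ}
    (hS : ∀ j m, S j m = -S m j) (hT : ∀ j m, T j m = T m j) :
    ∑ j, ∑ m, S j m * T j m = 0 := by
  have h : ∑ j, ∑ m, S j m * T j m = -∑ j, ∑ m, S j m * T j m := by
    conv_lhs => rw [Finset.sum_comm]
    simp only [← Finset.sum_neg_distrib]
    exact Finset.sum_congr rfl fun j _ => Finset.sum_congr rfl fun m _ => by
      rw [hS m j, hT m j, neg_mul]
  linarith

/-- Piola's identity: the second-order cofactors are antisymmetric in the differentiated column and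
the removed one, hence cancel the symmetric derivatives of a curl-free field. -/
theorem sum_fderiv_adjugate_eq_zero {A : E → Matrix n n ℝ} {x : E} {b : n → E}
    (hA : ∀ l m, DifferentiableAt ℝ (fun y => A y l m) x)
    (hcurl : ∀ l j m, fderiv ℝ (fun y => A y l m) x (b j) = fderiv ℝ (fun y => A y l j) x (b m))
    (i : n) : ∑ j, fderiv ℝ (fun y => (A y).adjugate j i) x (b j) = 0 := by
  have hderiv (j : n) : fderiv ℝ (fun y => (A y).adjugate j i) x (b j) =
      ∑ l, ∑ m, ((A x).updateRow i (Pi.single j 1)).adjugate m l *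
        (if l = i then 0 else fderiv ℝ (fun y => A y l m) x (b j)) := by
    simp only [adjugate_apply _ j i]
    have hrow (l m : n) : HasFDerivAt (fun y => (A y).updateRow i (Pi.single j 1) l m)
        (if l = i then 0 else fderiv ℝ (fun y => A y l m) x) x := by
      simp only [updateRow_apply]
      split_ifs
      exacts [hasFDerivAt_const _ _, (hA l m).hasFDerivAt]
    rw [(hasFDerivAt_det hrow).fderiv]
    simp only [_root_.sum_apply, _root_.smul_apply, smul_eq_mul]
    exact Finset.sum_congr rfl fun l _ => Finset.sum_congr rfl fun m _ => by
      split_ifs <;> simp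
  simp only [hderiv]
  rw [Finset.sum_comm]
  refine Finset.sum_eq_zero fun l _ => ?_
  rcases eq_or_ne l i with rfl | hl
  · simp
  simp only [if_neg hl]
  exact sum_mul_eq_zero_of_antisymm_of_symm
    (fun j m => adjugate_updateRow_single_antisymm (A x) hl j m) fun j m => hcurl l j m

end Determinant

section DirectionalDerivative

variable {E : Type*} [NormedAddCommGroup E] [NormedSpace ℝ E]

/-- The derivative of `f` in the direction `v`, as an operator on functions, so that it can be
iterated. -/
noncomputable def dirDeriv (v : E) (f : E → ℝ) : E → ℝ := fun x => fderiv ℝ f x v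

theorem contDiffOn_dirDeriv {f : E → ℝ} {m n : WithTop ℕ∞} {s : Set E} (hf : ContDiffOn ℝ n f s)
    (hs : IsOpen s) (hmn : m + 1 ≤ n) (v : E) : ContDiffOn ℝ m (dirDeriv v f) s :=
  (hf.fderiv_of_isOpen hs hmn).clm_apply contDiffOn_const

theorem contDiff_dirDeriv {f : E → ℝ} {m n : WithTop ℕ∞} (hf : ContDiff ℝ n f) (hmn : m + 1 ≤ n)
    (v : E) : ContDiff ℝ m (dirDeriv v f) :=
  (hf.fderiv_right hmn).clm_apply contDiff_const

theorem hasCompactSupport_dirDeriv {f : E → ℝ} (hf : HasCompactSupport f) (v : E) :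
    HasCompactSupport (dirDeriv v f) :=
  hf.fderiv_apply ℝ v

theorem dirDeriv_dirDeriv {f : E → ℝ} {x : E} (hf : ContDiffAt ℝ 2 f x) (v w : E) :
    dirDeriv v (dirDeriv w f) x = fderiv ℝ (fderiv ℝ f) x v w := by
  have hdf : DifferentiableAt ℝ (fderiv ℝ f) x :=
    (hf.fderiv_right (m := 1) (by norm_num)).differentiableAt (by norm_num)
  have h := fderiv_clm_apply hdf (differentiableAt_const w)
  change fderiv ℝ (fun y => fderiv ℝ f y w) x v = _
  simpa using congrArg (fun L : E →L[ℝ] ℝ => L v) h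

theorem dirDeriv_comm {f : E → ℝ} {x : E} (hf : ContDiffAt ℝ 2 f x) (v w : E) :
    dirDeriv v (dirDeriv w f) x = dirDeriv w (dirDeriv v f) x := by
  rw [dirDeriv_dirDeriv hf, dirDeriv_dirDeriv hf]
  exact hf.isSymmSndFDerivAt (by simp) v w

theorem dirDeriv_mul {f g : E → ℝ} {x : E} (hf : DifferentiableAt ℝ f x)
    (hg : DifferentiableAt ℝ g x) (v : E) :
    dirDeriv v (fun y => f y * g y) x = f x * dirDeriv v g x + dirDeriv v f x * g x := by
  simp only [dirDeriv, fderiv_fun_mul hf hg]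
  simp [mul_comm]

variable [FiniteDimensional ℝ E] [MeasurableSpace E] [BorelSpace E] {μ : Measure E}
  [μ.IsAddHaarMeasure]

theorem integral_mul_dirDeriv_eq_neg {f g : E → ℝ} (hf : ContDiff ℝ 1 f) (hg : ContDiff ℝ 1 g)
    (hg_supp : HasCompactSupport g) (v : E) :
    ∫ x, f x * dirDeriv v g x ∂μ = -∫ x, dirDeriv v f x * g x ∂μ := by
  have hf' : Continuous (dirDeriv v f) := (contDiff_dirDeriv (m := 0) hf (by simp) v).continuous
  have hg' : Continuous (dirDeriv v g) := (contDiff_dirDeriv (m := 0) hg (by simp) v).continuous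
  refine integral_mul_fderiv_eq_neg_fderiv_mul_of_integrable ?_ ?_ ?_
    (fun x _ => hf.differentiable one_ne_zero x) (fun x _ => hg.differentiable one_ne_zero x)
  · exact (hf'.mul hg.continuous).integrable_of_hasCompactSupport hg_supp.mul_left
  · exact (hf.continuous.mul hg').integrable_of_hasCompactSupport
      (hasCompactSupport_dirDeriv hg_supp v).mul_left
  · exact (hf.continuous.mul hg.continuous).integrable_of_hasCompactSupport hg_supp.mul_left

theorem integral_sum_mul_dirDeriv_mul_eq_neg {ι : Type*} [Fintype ι] {c : ι → E → ℝ} {b : ι → E}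
    {w φ : E → ℝ} (hc : ∀ j, ContDiff ℝ 1 (c j)) (hdiv : ∀ x, ∑ j, dirDeriv (b j) (c j) x = 0)
    (hw : ContDiff ℝ 1 w) (hφ : ContDiff ℝ 1 φ) (hφ_supp : HasCompactSupport φ) :
    ∫ x, (∑ j, c j x * dirDeriv (b j) w x) * φ x ∂μ =
      -∫ x, w x * ∑ j, c j x * dirDeriv (b j) φ x ∂μ := by
  have hdw (j : ι) : Continuous (dirDeriv (b j) w) :=
    (contDiff_dirDeriv (m := 0) hw (by simp) (b j)).continuous
  have hcφ (j : ι) : ContDiff ℝ 1 fun x => c j x * φ x := (hc j).mul hφ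
  have hcφ_supp (j : ι) : HasCompactSupport fun x => c j x * φ x := hφ_supp.mul_left
  have hdcφ (j : ι) : Continuous (dirDeriv (b j) fun x => c j x * φ x) :=
    (contDiff_dirDeriv (m := 0) (hcφ j) (by simp) (b j)).continuous
  have hflux (x : E) : ∑ j, dirDeriv (b j) (fun y => c j y * φ y) x =
      ∑ j, c j x * dirDeriv (b j) φ x := by
    simp only [dirDeriv_mul ((hc _).differentiable one_ne_zero x)
      (hφ.differentiable one_ne_zero x), Finset.sum_add_distrib, ← Finset.sum_mul, hdiv, zero_mul,
      add_zero]
  calc ∫ x, (∑ j, c j x * dirDeriv (b j) w x) * φ x ∂μ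
      = ∑ j, ∫ x, dirDeriv (b j) w x * (c j x * φ x) ∂μ := by
        rw [← integral_finsetSum]
        · exact integral_congr_ae (.of_forall fun x => by
            simp only [Finset.sum_mul]
            exact Finset.sum_congr rfl fun j _ => by ring)
        · exact fun j _ => ((hdw j).mul (hcφ j).continuous).integrable_of_hasCompactSupport
            (hcφ_supp j).mul_left
    _ = -∑ j, ∫ x, w x * dirDeriv (b j) (fun y => c j y * φ y) x ∂μ := by
        simp only [integral_mul_dirDeriv_eq_neg hw (hcφ _) (hcφ_supp _), Finset.sum_neg_distrib,
          neg_neg]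
    _ = -∫ x, w x * ∑ j, c j x * dirDeriv (b j) φ x ∂μ := by
        rw [← integral_finsetSum]
        · simp only [← Finset.mul_sum, hflux]
        · exact fun j _ => (hw.continuous.mul (hdcφ j)).integrable_of_hasCompactSupport
            (hasCompactSupport_dirDeriv (hcφ_supp j) (b j)).mul_left

section SymmetricCoefficients

variable {ι : Type*} [Fintype ι] {a : ι → ι → E → ℝ} {b : ι → E} {v φ : E → ℝ}

theorem integral_sum_mul_dirDeriv_dirDeriv_mul_eq_neg (ha : ∀ i j, ContDiff ℝ 1 (a i j))
    (hdiv : ∀ i x, ∑ j, dirDeriv (b j) (a i j) x = 0) (hv : ContDiff ℝ 2 v) (hφ : ContDiff ℝ 1 φ)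
    (hφ_supp : HasCompactSupport φ) :
    ∫ x, (∑ i, ∑ j, a i j x * dirDeriv (b j) (dirDeriv (b i) v) x) * φ x ∂μ =
      -∫ x, ∑ i, ∑ j, a i j x * dirDeriv (b i) v x * dirDeriv (b j) φ x ∂μ := by
  have ha_cont (i j : ι) : Continuous (a i j) := (ha i j).continuous
  have hφ_cont : Continuous φ := hφ.continuous
  have hdv (i : ι) : ContDiff ℝ 1 (dirDeriv (b i) v) := contDiff_dirDeriv hv (by norm_num) _
  have hdv_cont (i : ι) : Continuous (dirDeriv (b i) v) := (hdv i).continuous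
  have hddv (i j : ι) : Continuous (dirDeriv (b j) (dirDeriv (b i) v)) :=
    (contDiff_dirDeriv (m := 0) (hdv i) (by simp) _).continuous
  have hdφ (j : ι) : Continuous (dirDeriv (b j) φ) :=
    (contDiff_dirDeriv (m := 0) hφ (by simp) _).continuous
  simp only [Finset.sum_mul _ _ (φ _)]
  rw [integral_finsetSum, integral_finsetSum, ← Finset.sum_neg_distrib]
  · refine Finset.sum_congr rfl fun i _ => ?_
    simp only [← Finset.sum_mul _ _ (φ _)]
    rw [integral_sum_mul_dirDeriv_mul_eq_neg (ha i) (hdiv i) (hdv i) hφ hφ_supp]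
    simp only [Finset.mul_sum, mul_left_comm (dirDeriv (b i) v _), ← mul_assoc]
  · exact fun i _ => integrable_finsetSum _ fun j _ => Continuous.integrable_of_hasCompactSupport
      (by fun_prop) (hasCompactSupport_dirDeriv hφ_supp _).mul_left
  · exact fun i _ => integrable_finsetSum _ fun j _ => Continuous.integrable_of_hasCompactSupport
      (by fun_prop) hφ_supp.mul_left

theorem integral_mul_sum_mul_dirDeriv_dirDeriv_eq_neg (ha : ∀ i j, ContDiff ℝ 1 (a i j))
    (hdiv : ∀ i x, ∑ j, dirDeriv (b j) (a i j) x = 0) (hv : ContDiff ℝ 1 v) (hφ : ContDiff ℝ 2 φ)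
    (hφ_supp : HasCompactSupport φ) :
    ∫ x, v x * ∑ i, ∑ j, a i j x * dirDeriv (b j) (dirDeriv (b i) φ) x ∂μ =
      -∫ x, ∑ i, ∑ j, a i j x * dirDeriv (b j) v x * dirDeriv (b i) φ x ∂μ := by
  have ha_cont (i j : ι) : Continuous (a i j) := (ha i j).continuous
  have hv_cont : Continuous v := hv.continuous
  have hdv (j : ι) : Continuous (dirDeriv (b j) v) :=
    (contDiff_dirDeriv (m := 0) hv (by simp) _).continuous
  have hdφ (i : ι) : ContDiff ℝ 1 (dirDeriv (b i) φ) := contDiff_dirDeriv hφ (by norm_num) _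
  have hdφ_cont (i : ι) : Continuous (dirDeriv (b i) φ) := (hdφ i).continuous
  have hdφ_supp (i : ι) : HasCompactSupport (dirDeriv (b i) φ) :=
    hasCompactSupport_dirDeriv hφ_supp _
  have hddφ (i j : ι) : Continuous (dirDeriv (b j) (dirDeriv (b i) φ)) :=
    (contDiff_dirDeriv (m := 0) (hdφ i) (by simp) _).continuous
  simp only [Finset.mul_sum]
  rw [integral_finsetSum, integral_finsetSum, ← Finset.sum_neg_distrib]
  · refine Finset.sum_congr rfl fun i _ => ?_
    simp only [← Finset.mul_sum, ← Finset.sum_mul _ _ (dirDeriv (b i) φ _)]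
    rw [integral_sum_mul_dirDeriv_mul_eq_neg (ha i) (hdiv i) hv (hdφ i) (hdφ_supp i), neg_neg]
  · exact fun i _ => integrable_finsetSum _ fun j _ => Continuous.integrable_of_hasCompactSupport
      (by fun_prop) (hdφ_supp i).mul_left
  · exact fun i _ => integrable_finsetSum _ fun j _ => Continuous.integrable_of_hasCompactSupport
      (by fun_prop) (hasCompactSupport_dirDeriv (hdφ_supp i) _).mul_left.mul_left

theorem integral_sum_mul_dirDeriv_dirDeriv_mul (ha : ∀ i j, ContDiff ℝ 1 (a i j))
    (ha_symm : ∀ i j, a i j = a j i) (hdiv : ∀ i x, ∑ j, dirDeriv (b j) (a i j) x = 0)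
    (hv : ContDiff ℝ 2 v) (hφ : ContDiff ℝ 2 φ) (hφ_supp : HasCompactSupport φ) :
    ∫ x, (∑ i, ∑ j, a i j x * dirDeriv (b j) (dirDeriv (b i) v) x) * φ x ∂μ =
      ∫ x, v x * ∑ i, ∑ j, a i j x * dirDeriv (b j) (dirDeriv (b i) φ) x ∂μ := by
  rw [integral_sum_mul_dirDeriv_dirDeriv_mul_eq_neg ha hdiv hv (hφ.of_le one_le_two) hφ_supp,
    integral_mul_sum_mul_dirDeriv_dirDeriv_eq_neg ha hdiv (hv.of_le one_le_two) hφ hφ_supp]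
  congr! 3 with x
  rw [Finset.sum_comm]
  simp only [ha_symm]

end SymmetricCoefficients

end DirectionalDerivative

section Hessian

variable {N : ℕ}

/-- The `i`-th vector of the standard basis of `ℝᴺ`. -/
noncomputable abbrev stdVec (i : Fin N) : EuclideanSpace ℝ (Fin N) := EuclideanSpace.single i 1

theorem hessianMatrix_apply_eq_dirDeriv {u : EuclideanSpace ℝ (Fin N) → ℝ}
    {x : EuclideanSpace ℝ (Fin N)} (hu : ContDiffAt ℝ 2 u x) (i j : Fin N) :
    hessianMatrix u x i j = dirDeriv (stdVec i) (dirDeriv (stdVec j) u) x :=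
  (dirDeriv_dirDeriv hu _ _).symm

theorem transpose_hessianMatrix {u : EuclideanSpace ℝ (Fin N) → ℝ}
    {x : EuclideanSpace ℝ (Fin N)} (hu : ContDiffAt ℝ 2 u x) :
    (hessianMatrix u x).transpose = hessianMatrix u x := by
  ext i j
  exact hu.isSymmSndFDerivAt (by simp) _ _

theorem adjugate_hessianMatrix_comm {u : EuclideanSpace ℝ (Fin N) → ℝ}
    {x : EuclideanSpace ℝ (Fin N)} (hu : ContDiffAt ℝ 2 u x) (i j : Fin N) :
    (hessianMatrix u x).adjugate i j = (hessianMatrix u x).adjugate j i := by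
  conv_lhs => rw [← transpose_hessianMatrix hu, ← Matrix.adjugate_transpose]
  rfl

theorem hessianMatrix_sub {u v : EuclideanSpace ℝ (Fin N) → ℝ} (hu : ContDiff ℝ 2 u)
    (hv : ContDiff ℝ 2 v) (x : EuclideanSpace ℝ (Fin N)) :
    hessianMatrix (u - v) x = hessianMatrix u x - hessianMatrix v x := by
  have hfderiv : fderiv ℝ (u - v) = fderiv ℝ u - fderiv ℝ v :=
    funext fun y => fderiv_sub (hu.differentiable two_ne_zero y) (hv.differentiable two_ne_zero y)
  have hfderiv₂ := fderiv_sub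
    ((hu.fderiv_right (m := 1) (by norm_num)).differentiable one_ne_zero x)
    ((hv.fderiv_right (m := 1) (by norm_num)).differentiable one_ne_zero x)
  ext i j
  simp [hessianMatrix, hfderiv, hfderiv₂]

theorem contDiff_hessianMatrix {u : EuclideanSpace ℝ (Fin N) → ℝ} {m n : WithTop ℕ∞}
    (hu : ContDiff ℝ n u) (hmn : m + 2 ≤ n) (i j : Fin N) :
    ContDiff ℝ m fun x => hessianMatrix u x i j := by
  have hm : m + 1 + 1 ≤ n := by rwa [add_assoc, one_add_one_eq_two]
  have hu2 : ContDiff ℝ 2 u := hu.of_le (le_add_self.trans hmn)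
  simp only [hessianMatrix_apply_eq_dirDeriv hu2.contDiffAt]
  exact contDiff_dirDeriv (contDiff_dirDeriv hu hm (stdVec j)) le_rfl (stdVec i)

theorem contDiff_adjugate_hessianMatrix {u : EuclideanSpace ℝ (Fin N) → ℝ} {m n : WithTop ℕ∞}
    (hu : ContDiff ℝ n u) (hmn : m + 2 ≤ n) (i j : Fin N) :
    ContDiff ℝ m fun x => (hessianMatrix u x).adjugate i j :=
  contDiffOn_univ.1 <|
    contDiffOn_adjugate (fun k l => (contDiff_hessianMatrix hu hmn k l).contDiffOn) i j

theorem sum_dirDeriv_adjugate_hessianMatrix_eq_zero {u : EuclideanSpace ℝ (Fin N) → ℝ}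
    (hu : ContDiff ℝ 3 u) (i : Fin N) (x : EuclideanSpace ℝ (Fin N)) :
    ∑ j, dirDeriv (stdVec j) (fun y => (hessianMatrix u y).adjugate j i) x = 0 := by
  have hu2 : ContDiff ℝ 2 u := hu.of_le (by norm_num)
  refine sum_fderiv_adjugate_eq_zero (b := stdVec)
    (fun l m => (contDiff_hessianMatrix hu (m := 1) (by norm_num) l m).differentiable
      one_ne_zero x) (fun l j m => ?_) i
  have hrow (m : Fin N) : (fun y => hessianMatrix u y l m) =
      dirDeriv (stdVec m) (dirDeriv (stdVec l) u) := by
    ext y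
    rw [hessianMatrix_apply_eq_dirDeriv hu2.contDiffAt, dirDeriv_comm hu2.contDiffAt]
  rw [hrow, hrow]
  exact dirDeriv_comm (contDiff_dirDeriv (m := 2) hu (by norm_num) _).contDiffAt _ _

theorem integral_trace_adjugate_mul_hessianMatrix_mul {u v φ : EuclideanSpace ℝ (Fin N) → ℝ}
    (hu : ContDiff ℝ 3 u) (hv : ContDiff ℝ 2 v) (hφ : ContDiff ℝ 2 φ)
    (hφ_supp : HasCompactSupport φ) :
    ∫ x, ((hessianMatrix u x).adjugate * hessianMatrix v x).trace * φ x =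
      ∫ x, v x * ((hessianMatrix u x).adjugate * hessianMatrix φ x).trace := by
  have hu2 : ContDiff ℝ 2 u := hu.of_le (by norm_num)
  have hA_symm (i j : Fin N) : (fun x => (hessianMatrix u x).adjugate i j) =
      fun x => (hessianMatrix u x).adjugate j i :=
    funext fun x => adjugate_hessianMatrix_comm hu2.contDiffAt i j
  have htrace {w : EuclideanSpace ℝ (Fin N) → ℝ} (hw : ContDiff ℝ 2 w) (x) :
      ((hessianMatrix u x).adjugate * hessianMatrix w x).trace = ∑ i, ∑ j,
        (hessianMatrix u x).adjugate i j * dirDeriv (stdVec j) (dirDeriv (stdVec i) w) x := by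
    simp only [Matrix.trace, Matrix.diag_apply, Matrix.mul_apply,
      hessianMatrix_apply_eq_dirDeriv hw.contDiffAt]
  simp only [htrace hv, htrace hφ]
  refine integral_sum_mul_dirDeriv_dirDeriv_mul
    (fun i j => contDiff_adjugate_hessianMatrix hu (by norm_num) i j) hA_symm (fun i x => ?_)
    hv hφ hφ_supp
  simp only [hA_symm i]
  exact sum_dirDeriv_adjugate_hessianMatrix_eq_zero hu i x

end Hessian

section PartialDerivatives

variable {E : Type*} [NormedAddCommGroup E] [NormedSpace ℝ E] {g : ℝ × E → ℝ} {t : ℝ} {x : E}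

theorem hasDerivAt_dirDeriv_one_zero (hg : DifferentiableAt ℝ g (t, x)) :
    HasDerivAt (fun s => g (s, x)) (dirDeriv ((1 : ℝ), (0 : E)) g (t, x)) t :=
  hg.hasFDerivAt.comp_hasDerivAt t ((hasDerivAt_id t).prodMk (hasDerivAt_const t x))

theorem dirDeriv_zero_prodMk (hg : DifferentiableAt ℝ g (t, x)) (v : E) :
    dirDeriv ((0 : ℝ), v) g (t, x) = dirDeriv v (fun y => g (t, y)) x := by
  have h : HasFDerivAt (fun y => g (t, y)) _ x :=
    hg.hasFDerivAt.comp x (hasFDerivAt_prodMk_right t x)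
  simp [dirDeriv, h.fderiv]

theorem Ioi_prod_univ_mem_nhds {X : Type*} [TopologicalSpace X] {t : ℝ} (ht : 0 < t) (x : X) :
    Set.Ioi 0 ×ˢ Set.univ ∈ nhds (t, x) :=
  prod_mem_nhds (Ioi_mem_nhds ht) Filter.univ_mem

end PartialDerivatives

section Mollification

open scoped Convolution ContDiff
open Metric Set

variable {E : Type*} [NormedAddCommGroup E] [InnerProductSpace ℝ E] [FiniteDimensional ℝ E]
  [MeasurableSpace E] [BorelSpace E]

/-- A fixed even smooth probability density supported in the open unit ball. -/
noncomputable def mollifier (E : Type*) [NormedAddCommGroup E] [InnerProductSpace ℝ E]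
    [FiniteDimensional ℝ E] [MeasurableSpace E] [BorelSpace E] : E → ℝ :=
  (⟨1 / 4, 1 / 2, by norm_num, by norm_num⟩ : ContDiffBump (0 : E)).normed volume

theorem contDiff_mollifier {n : ℕ∞} : ContDiff ℝ n (mollifier E) := ContDiffBump.contDiff_normed _

theorem continuous_mollifier : Continuous (mollifier E) := (contDiff_mollifier (n := 0)).continuous

theorem mollifier_neg (z : E) : mollifier E (-z) = mollifier E z := ContDiffBump.normed_neg _ z

theorem mollifier_nonneg (z : E) : 0 ≤ mollifier E z := ContDiffBump.nonneg_normed _ z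

theorem integral_mollifier : ∫ z, mollifier E z = 1 := ContDiffBump.integral_normed _

theorem hasCompactSupport_mollifier : HasCompactSupport (mollifier E) :=
  ContDiffBump.hasCompactSupport_normed _

theorem integrable_mollifier : Integrable (mollifier E) :=
  continuous_mollifier.integrable_of_hasCompactSupport hasCompactSupport_mollifier

theorem tsupport_mollifier_subset : tsupport (mollifier E) ⊆ ball 0 1 := by
  rw [mollifier, ContDiffBump.tsupport_normed_eq]
  exact closedBall_subset_ball (by norm_num)

theorem mollifier_eq_zero {z : E} (hz : 1 ≤ ‖z‖) : mollifier E z = 0 := by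
  by_contra h
  exact hz.not_gt (mem_ball_zero_iff.1 (tsupport_mollifier_subset (subset_tsupport _ h)))

theorem fderiv_mollifier_eq_zero {z : E} (hz : 1 ≤ ‖z‖) : fderiv ℝ (mollifier E) z = 0 := by
  by_contra h
  exact hz.not_gt (mem_ball_zero_iff.1 (tsupport_mollifier_subset (support_fderiv_subset ℝ h)))

/-- The mollification of `f` at scale `t`. Averaging over the unit ball rather than over the ball
of radius `t` lets the definition make sense at `t = 0`, where it returns `f`. -/
noncomputable def moll (f : E → ℝ) (t : ℝ) (x : E) : ℝ := ∫ z, mollifier E z * f (x - t • z)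

theorem moll_zero (f : E → ℝ) (x : E) : moll f 0 x = f x := by
  simp [moll, integral_mul_const, integral_mollifier]

theorem moll_sub {f g : E → ℝ} (hf : Continuous f) (hg : Continuous g) (t : ℝ) :
    moll (f - g) t = moll f t - moll g t := by
  have hint {h : E → ℝ} (hh : Continuous h) (x : E) :
      Integrable fun z => mollifier E z * h (x - t • z) :=
    (continuous_mollifier.mul (by fun_prop)).integrable_of_hasCompactSupport
      hasCompactSupport_mollifier.mul_right
  ext x
  simp only [moll, Pi.sub_apply, mul_sub]
  exact integral_sub (hint hf x) (hint hg x)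

theorem norm_mollifier_mul_le {f : E → ℝ} {M : ℝ} (hM : ∀ x, |f x| ≤ M) (x z : E) :
    ‖mollifier E z * f x‖ ≤ mollifier E z * M := by
  rw [norm_mul, Real.norm_of_nonneg (mollifier_nonneg z)]
  exact mul_le_mul_of_nonneg_left (hM x) (mollifier_nonneg z)

theorem continuous_moll {f : E → ℝ} (hf : Continuous f) {M : ℝ} (hM : ∀ x, |f x| ≤ M) :
    Continuous fun q : ℝ × E => moll f q.1 q.2 :=
  continuous_of_dominated
    (fun _ => (continuous_mollifier.mul (by fun_prop)).aestronglyMeasurable)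
    (fun q => .of_forall fun z => norm_mollifier_mul_le hM (q.2 - q.1 • z) z)
    (integrable_mollifier.mul_const M) (.of_forall fun z => by fun_prop)

/-- The mollifier rescaled to the ball of radius `t`, with integral `1`. -/
noncomputable def mollKernel (t : ℝ) (y : E) : ℝ :=
  (t ^ Module.finrank ℝ E)⁻¹ * mollifier E (t⁻¹ • y)

theorem mollKernel_eq_zero {t : ℝ} (ht : 0 < t) {y : E} (hy : t ≤ ‖y‖) : mollKernel t y = 0 := by
  rw [mollKernel, mollifier_eq_zero, mul_zero]
  rwa [norm_smul, norm_inv, Real.norm_of_nonneg ht.le, inv_mul_eq_div, one_le_div ht]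

theorem contDiffOn_mollKernel :
    ContDiffOn ℝ ∞ (fun q : ℝ × E => mollKernel q.1 q.2) (Ioi 0 ×ˢ univ) := by
  have hinv : ContDiffOn ℝ ∞ (fun q : ℝ × E => q.1⁻¹) (Ioi 0 ×ˢ univ) :=
    contDiffOn_fst.inv fun q hq => hq.1.ne'
  have hpow : ContDiffOn ℝ ∞ (fun q : ℝ × E => (q.1 ^ Module.finrank ℝ E)⁻¹) (Ioi 0 ×ˢ univ) :=
    (contDiffOn_fst.pow _).inv fun q hq => pow_ne_zero _ hq.1.ne'
  exact hpow.mul (contDiff_mollifier.comp_contDiffOn (hinv.smul contDiffOn_snd))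

theorem integral_comp_sub_smul (g : E → ℝ) {t : ℝ} (ht : 0 ≤ t) (x : E) :
    ∫ z, g (x - t • z) = (t ^ Module.finrank ℝ E)⁻¹ * ∫ y, g y := by
  rw [Measure.integral_comp_smul_of_nonneg (μ := volume) (fun w => g (x - w)) t (hR := ht),
    integral_sub_left_eq_self g volume x, smul_eq_mul]

theorem moll_eq_convolution (f : E → ℝ) {t : ℝ} (ht : 0 < t) :
    moll f t = f ⋆[ContinuousLinearMap.mul ℝ ℝ, volume] mollKernel t := by
  ext x
  have h := integral_comp_sub_smul (fun y => mollifier E (t⁻¹ • (x - y)) * f y) ht.le x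
  simp only [sub_sub_cancel, smul_smul, inv_mul_cancel₀ ht.ne', one_smul] at h
  rw [moll, h, ← integral_const_mul]
  exact integral_congr_ae (.of_forall fun y => by
    simp only [mollKernel, ContinuousLinearMap.mul_apply']
    ring)

theorem contDiffOn_moll {f : E → ℝ} (hf : Continuous f) :
    ContDiffOn ℝ ∞ (fun q : ℝ × E => moll f q.1 q.2) (Ioi 0 ×ˢ univ) := by
  rintro ⟨t, x⟩ ⟨ht, -⟩
  have hsub : Ioo 0 (t + 1) ×ˢ (univ : Set E) ⊆ Ioi 0 ×ˢ univ :=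
    prod_mono_left Ioo_subset_Ioi_self
  have hconv := contDiffOn_convolution_right_with_param (n := ⊤) (μ := volume)
    (ContinuousLinearMap.mul ℝ ℝ) (g := mollKernel) isOpen_Ioo
    (isCompact_closedBall (0 : E) (t + 1))
    (fun s y hs hy => mollKernel_eq_zero hs.1 (by
      rw [mem_closedBall_zero_iff, not_le] at hy
      exact hs.2.le.trans hy.le))
    (hf.locallyIntegrable (μ := volume)) (contDiffOn_mollKernel.mono hsub)
  refine ((hconv.congr fun q hq => ?_).contDiffAt ((isOpen_Ioo.prod isOpen_univ).mem_nhds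
    ⟨⟨ht, by simp⟩, mem_univ x⟩)).contDiffWithinAt
  rw [moll_eq_convolution f hq.1.1]

theorem contDiffAt_moll {f : E → ℝ} (hf : Continuous f) {n : ℕ∞} {t : ℝ} (ht : 0 < t) (x : E) :
    ContDiffAt ℝ n (fun q : ℝ × E => moll f q.1 q.2) (t, x) :=
  ((contDiffOn_moll hf).contDiffAt (Ioi_prod_univ_mem_nhds ht x)).of_le (by exact_mod_cast le_top)

theorem contDiff_moll {f : E → ℝ} (hf : Continuous f) {n : ℕ∞} {t : ℝ} (ht : 0 < t) :
    ContDiff ℝ n (moll f t) :=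
  contDiff_iff_contDiffAt.2 fun x =>
    (contDiffAt_moll hf ht x).comp x (contDiff_prodMk_right t).contDiffAt

theorem hasDerivAt_moll_line {f : E → ℝ} (hf : ContDiff ℝ 1 f) (hf_supp : HasCompactSupport f)
    (a t : ℝ) (v x : E) :
    HasDerivAt (fun s => moll f (t + s * a) (x + s • v))
      (∫ z, mollifier E z * fderiv ℝ f (x - t • z) (v - a • z)) 0 := by
  have hf' : Continuous (fderiv ℝ f) := hf.continuous_fderiv one_ne_zero
  obtain ⟨M, hM⟩ := (hf_supp.fderiv ℝ).exists_bound_of_continuous hf'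
  have hρ : Continuous (mollifier E) := continuous_mollifier
  have hf_cont : Continuous f := hf.continuous
  have hderiv (s : ℝ) (z : E) :
      HasDerivAt (fun s => mollifier E z * f (x + s • v - (t + s * a) • z))
        (mollifier E z * fderiv ℝ f (x + s • v - (t + s * a) • z) (v - a • z)) s := by
    have hline : HasDerivAt (fun s : ℝ => x + s • v - (t + s * a) • z) (v - a • z) s := by
      have h1 := ((hasDerivAt_id s).smul_const v).const_add x
      have h2 := (((hasDerivAt_id s).mul_const a).const_add t).smul_const z
      simpa using h1.fun_sub h2
    exact ((hf.differentiable one_ne_zero _).hasFDerivAt.comp_hasDerivAt s hline).const_mul _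
  have h := (hasDerivAt_integral_of_dominated_loc_of_deriv_le (μ := volume) (x₀ := (0 : ℝ))
    (bound := fun z => mollifier E z * (M * ‖v - a • z‖)) Filter.univ_mem
    (.of_forall fun s => Continuous.aestronglyMeasurable (by fun_prop))
    (Continuous.integrable_of_hasCompactSupport (by fun_prop)
      hasCompactSupport_mollifier.mul_right)
    (Continuous.aestronglyMeasurable (by fun_prop))
    (.of_forall fun z s _ => ?_)
    (Continuous.integrable_of_hasCompactSupport (by fun_prop)
      hasCompactSupport_mollifier.mul_right)
    (.of_forall fun z s _ => hderiv s z)).2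
  · simpa [moll] using h
  · rw [norm_mul, Real.norm_of_nonneg (mollifier_nonneg z)]
    exact mul_le_mul_of_nonneg_left
      ((fderiv ℝ f _).le_of_opNorm_le (hM _) _) (mollifier_nonneg z)

theorem dirDeriv_moll_prod {f : E → ℝ} (hf : ContDiff ℝ 1 f) (hf_supp : HasCompactSupport f)
    {t : ℝ} (ht : 0 < t) (a : ℝ) (v x : E) :
    dirDeriv (a, v) (fun q : ℝ × E => moll f q.1 q.2) (t, x) =
      ∫ z, mollifier E z * fderiv ℝ f (x - t • z) (v - a • z) := by
  have hdiff : DifferentiableAt ℝ (fun q : ℝ × E => moll f q.1 q.2) (t, x) :=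
    (contDiffAt_moll hf.continuous (n := 1) ht x).differentiableAt (by simp)
  refine (hdiff.hasFDerivAt.hasLineDerivAt (a, v)).unique ?_
  simpa [HasLineDerivAt] using hasDerivAt_moll_line hf hf_supp a t v x

theorem dirDeriv_moll {f : E → ℝ} (hf : ContDiff ℝ 1 f) (hf_supp : HasCompactSupport f)
    {t : ℝ} (ht : 0 < t) (v : E) : dirDeriv v (moll f t) = moll (dirDeriv v f) t := by
  ext x
  rw [← dirDeriv_zero_prodMk (g := fun q : ℝ × E => moll f q.1 q.2)
    ((contDiffAt_moll hf.continuous (n := 1) ht x).differentiableAt (by simp)),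
    dirDeriv_moll_prod hf hf_supp ht]
  simp [moll, dirDeriv]

/-- The derivative of the mollification with respect to the scale. -/
noncomputable def mollTime (f : E → ℝ) (t : ℝ) (x : E) : ℝ :=
  dirDeriv ((1 : ℝ), (0 : E)) (fun q : ℝ × E => moll f q.1 q.2) (t, x)

theorem hasDerivAt_moll {f : E → ℝ} (hf : Continuous f) {t : ℝ} (ht : 0 < t) (x : E) :
    HasDerivAt (fun s => moll f s x) (mollTime f t x) t :=
  hasDerivAt_dirDeriv_one_zero ((contDiffAt_moll hf (n := 1) ht x).differentiableAt (by simp))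

theorem mollTime_sub {f g : E → ℝ} (hf : Continuous f) (hg : Continuous g) {t : ℝ} (ht : 0 < t)
    (x : E) : mollTime (f - g) t x = mollTime f t x - mollTime g t x := by
  refine (hasDerivAt_moll (hf.sub hg) ht x).unique ?_
  simp only [moll_sub hf hg]
  exact (hasDerivAt_moll hf ht x).sub (hasDerivAt_moll hg ht x)

theorem contDiffOn_mollTime {f : E → ℝ} (hf : Continuous f) :
    ContDiffOn ℝ ∞ (fun q : ℝ × E => mollTime f q.1 q.2) (Ioi 0 ×ˢ univ) :=
  contDiffOn_dirDeriv (contDiffOn_moll hf) (isOpen_Ioi.prod isOpen_univ) (by simp) _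

theorem contDiffAt_mollTime {f : E → ℝ} (hf : Continuous f) {n : ℕ∞} {t : ℝ} (ht : 0 < t)
    (x : E) : ContDiffAt ℝ n (fun q : ℝ × E => mollTime f q.1 q.2) (t, x) :=
  ((contDiffOn_mollTime hf).contDiffAt (Ioi_prod_univ_mem_nhds ht x)).of_le
    (by exact_mod_cast le_top)

theorem contDiff_mollTime {f : E → ℝ} (hf : Continuous f) {n : ℕ∞} {t : ℝ} (ht : 0 < t) :
    ContDiff ℝ n (mollTime f t) :=
  contDiff_iff_contDiffAt.2 fun x =>
    (contDiffAt_mollTime hf ht x).comp x (contDiff_prodMk_right t).contDiffAt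

theorem dirDeriv_mollTime {f : E → ℝ} (hf : ContDiff ℝ 1 f) (hf_supp : HasCompactSupport f)
    {t : ℝ} (ht : 0 < t) (v : E) : dirDeriv v (mollTime f t) = mollTime (dirDeriv v f) t := by
  ext x
  have hspace : dirDeriv ((0 : ℝ), v) (fun q : ℝ × E => moll f q.1 q.2) =ᶠ[nhds (t, x)]
      fun q : ℝ × E => moll (dirDeriv v f) q.1 q.2 := by
    filter_upwards [Ioi_prod_univ_mem_nhds ht x] with q hq
    rw [← dirDeriv_moll hf hf_supp hq.1]
    exact dirDeriv_zero_prodMk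
      ((contDiffAt_moll hf.continuous (n := 1) hq.1 q.2).differentiableAt (by simp)) v
  calc dirDeriv v (mollTime f t) x
      = dirDeriv ((0 : ℝ), v) (fun q : ℝ × E => mollTime f q.1 q.2) (t, x) :=
        (dirDeriv_zero_prodMk
          ((contDiffAt_mollTime hf.continuous (n := 1) ht x).differentiableAt (by simp)) v).symm
    _ = dirDeriv ((1 : ℝ), (0 : E))
          (dirDeriv ((0 : ℝ), v) fun q : ℝ × E => moll f q.1 q.2) (t, x) :=
        dirDeriv_comm (contDiffAt_moll hf.continuous (n := 2) ht x) _ _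
    _ = mollTime (dirDeriv v f) t x := by
        rw [mollTime, dirDeriv, hspace.fderiv_eq, dirDeriv]

end Mollification

section MeanOscillation

open Metric Set

variable {E G : Type*} [NormedAddCommGroup E] [InnerProductSpace ℝ E] [FiniteDimensional ℝ E]
  [MeasurableSpace E] [BorelSpace E] [NormedAddCommGroup G]

/-- The mean over the ball of radius `t` around `x` of the distance from `F` to its value at the
centre. It measures the smoothness of `F` at scale `t`. -/
noncomputable def meanOsc (F : E → G) (t : ℝ) (x : E) : ℝ :=
  ⨍ y in closedBall x t, ‖F y - F x‖

theorem meanOsc_nonneg (F : E → G) (t : ℝ) (x : E) : 0 ≤ meanOsc F t x :=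
  integral_nonneg fun _ => norm_nonneg _

theorem setAverage_closedBall_comp_sub_smul (g : E → ℝ) {t : ℝ} (ht : 0 < t) (x : E) :
    ⨍ z in closedBall (0 : E) 1, g (x - t • z) = ⨍ y in closedBall x t, g y := by
  have hmem (z : E) : x - t • z ∈ closedBall x t ↔ z ∈ closedBall (0 : E) 1 := by
    rw [mem_closedBall, dist_self_sub_left, norm_smul, Real.norm_of_nonneg ht.le,
      mul_le_iff_le_one_right ht, mem_closedBall_zero_iff]
  have hint : ∫ z in closedBall (0 : E) 1, g (x - t • z) =
      (t ^ Module.finrank ℝ E)⁻¹ * ∫ y in closedBall x t, g y := by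
    rw [← integral_indicator measurableSet_closedBall, ← integral_indicator
      measurableSet_closedBall, ← integral_comp_sub_smul _ ht.le x]
    congr! 2 with z
    by_cases hz : z ∈ closedBall (0 : E) 1
    · rw [indicator_of_mem hz, indicator_of_mem ((hmem z).2 hz)]
    · rw [indicator_of_notMem hz, indicator_of_notMem (mt (hmem z).1 hz)]
  rw [setAverage_eq, setAverage_eq, hint, Measure.addHaar_real_closedBall' volume x ht.le]
  simp only [smul_eq_mul, mul_inv]
  ring

theorem continuousOn_meanOsc {F : E → G} (hF : Continuous F) :
    ContinuousOn (fun q : ℝ × E => meanOsc F q.1 q.2) (Ioi 0 ×ˢ univ) := by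
  have hcont : Continuous fun q : ℝ × E =>
      ∫ z in closedBall (0 : E) 1, ‖F (q.2 - q.1 • z) - F q.2‖ :=
    continuous_parametric_integral_of_continuous (by fun_prop) (isCompact_closedBall 0 1)
  refine (hcont.const_smul (volume.real (closedBall (0 : E) 1))⁻¹).continuousOn.congr ?_
  rintro ⟨t, x⟩ ⟨ht, -⟩
  change meanOsc F t x = _
  rw [meanOsc, ← setAverage_closedBall_comp_sub_smul (fun y => ‖F y - F x‖) ht x, setAverage_eq]
  rfl

theorem meanOsc_le {F : E → G} {M : ℝ} (hM : ∀ x, ‖F x‖ ≤ M) {t : ℝ} (ht : 0 < t) (x : E) :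
    meanOsc F t x ≤ 2 * M := by
  have hball : 0 < volume.real (closedBall x t) :=
    ENNReal.toReal_pos (measure_closedBall_pos volume x ht).ne' measure_closedBall_lt_top.ne
  have h : ∫ y in closedBall x t, ‖F y - F x‖ ≤ 2 * M * volume.real (closedBall x t) :=
    (Real.le_norm_self _).trans <| norm_setIntegral_le_of_norm_le_const measure_closedBall_lt_top
      fun y _ => by
        rw [norm_norm, two_mul]
        exact norm_sub_le_of_le (hM y) (hM x)
  rw [meanOsc, setAverage_eq, smul_eq_mul, inv_mul_le_iff₀ hball, mul_comm]
  exact h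

variable [NormedSpace ℝ G] [CompleteSpace G]

/-- A kernel of integral zero does not see the constant `F x`, so only the oscillation counts. -/
theorem abs_integral_comp_sub_smul_apply_le {F : E → G →L[ℝ] ℝ} (hF : Continuous F)
    {b : E → G} (hb : Continuous b) (hb_supp : ∀ z, 1 ≤ ‖z‖ → b z = 0) (hb_int : ∫ z, b z = 0)
    {K : ℝ} (hK : ∀ z, ‖b z‖ ≤ K) {t : ℝ} (ht : 0 < t) (x : E) :
    |∫ z, F (x - t • z) (b z)| ≤ K * volume.real (closedBall (0 : E) 1) * meanOsc F t x := by
  have hb_compl (z : E) (hz : z ∉ closedBall (0 : E) 1) : b z = 0 :=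
    hb_supp z (le_of_lt (by simpa using hz))
  have hsupp : HasCompactSupport b := .intro (isCompact_closedBall 0 1) hb_compl
  have happly (F' : E → G →L[ℝ] ℝ) (hF' : Continuous F') : Integrable fun z => F' z (b z) :=
    (hF'.clm_apply hb).integrable_of_hasCompactSupport <|
      hsupp.mono' fun z hz => subset_tsupport _ fun h => hz (by simp [h])
  have hconst : ∫ z, F x (b z) = 0 := by
    rw [(F x).integral_comp_comm (hb.integrable_of_hasCompactSupport hsupp), hb_int, map_zero]
  have hosc : ∫ z, F (x - t • z) (b z) =
      ∫ z in closedBall (0 : E) 1, (F (x - t • z) - F x) (b z) := by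
    rw [setIntegral_eq_integral_of_forall_compl_eq_zero fun z hz => by rw [hb_compl z hz, map_zero]]
    simp only [sub_apply]
    rw [integral_sub (happly _ (by fun_prop)) (happly _ continuous_const), hconst, sub_zero]
  calc |∫ z, F (x - t • z) (b z)|
      ≤ ∫ z in closedBall (0 : E) 1, K * ‖F (x - t • z) - F x‖ := by
        rw [hosc, ← Real.norm_eq_abs]
        refine norm_integral_le_of_norm_le (ContinuousOn.integrableOn_compact
          (isCompact_closedBall 0 1) (by fun_prop)) (.of_forall fun z => ?_)
        rw [mul_comm]
        exact (F (x - t • z) - F x).le_opNorm_of_le (hK z)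
    _ = K * volume.real (closedBall (0 : E) 1) * meanOsc F t x := by
        rw [meanOsc, ← setAverage_closedBall_comp_sub_smul _ ht, integral_const_mul, mul_assoc,
          ← smul_eq_mul (volume.real _), measure_smul_setAverage _ measure_closedBall_lt_top.ne]

end MeanOscillation

section MollificationBounds

open Metric

variable {E : Type*} [NormedAddCommGroup E] [InnerProductSpace ℝ E] [FiniteDimensional ℝ E]
  [MeasurableSpace E] [BorelSpace E]

variable (E) in
theorem exists_abs_mollTime_le :
    ∃ K : ℝ, 0 ≤ K ∧ ∀ u : E → ℝ, ContDiff ℝ 1 u → HasCompactSupport u → ∀ t, 0 < t → ∀ x,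
      |mollTime u t x| ≤ K * meanOsc (fderiv ℝ u) t x := by
  set b : E → E := fun z => -(mollifier E z • z)
  have hb : Continuous b := (continuous_mollifier.smul continuous_id).neg
  have hb_supp (z : E) (hz : 1 ≤ ‖z‖) : b z = 0 := by simp [b, mollifier_eq_zero hz]
  have hb_int : ∫ z, b z = 0 := by
    have hodd (z : E) : b (-z) = -b z := by simp [b, mollifier_neg]
    have h := integral_neg_eq_self b volume
    simp only [hodd, integral_neg] at h
    have : IsAddTorsionFree E := .of_isTorsionFree ℝ E
    exact self_eq_neg.1 h.symm
  obtain ⟨K, hK⟩ := (HasCompactSupport.intro (isCompact_closedBall 0 1) fun z hz =>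
    hb_supp z (le_of_lt (by simpa using hz))).exists_bound_of_continuous hb
  have hK0 : 0 ≤ K := (norm_nonneg _).trans (hK 0)
  refine ⟨K * volume.real (closedBall (0 : E) 1), by positivity, fun u hu hu_supp t ht x => ?_⟩
  rw [mollTime, dirDeriv_moll_prod hu hu_supp ht]
  simpa [b] using abs_integral_comp_sub_smul_apply_le (hu.continuous_fderiv one_ne_zero) hb
    hb_supp hb_int hK ht x

theorem mul_dirDeriv_moll {f : E → ℝ} (hf : ContDiff ℝ 1 f) (hf_supp : HasCompactSupport f)
    {t : ℝ} (ht : 0 < t) (v x : E) :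
    t * dirDeriv v (moll f t) x = ∫ z, f (x - t • z) * dirDeriv v (mollifier E) z := by
  have hderiv (z : E) : dirDeriv v (fun z => f (x - t • z)) z = -t * dirDeriv v f (x - t • z) := by
    have hline : HasFDerivAt (fun z : E => x - t • z) (-(t • ContinuousLinearMap.id ℝ E)) z := by
      simpa using ((hasFDerivAt_id z).const_smul t).const_sub x
    have hcomp : HasFDerivAt (fun z => f (x - t • z)) _ z :=
      (hf.differentiable one_ne_zero (x - t • z)).hasFDerivAt.comp z hline
    simp [dirDeriv, hcomp.fderiv]
  rw [integral_mul_dirDeriv_eq_neg (f := fun z => f (x - t • z)) (hf.comp (by fun_prop))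
    (contDiff_mollifier (n := 1)) hasCompactSupport_mollifier, dirDeriv_moll hf hf_supp ht, moll,
    ← integral_const_mul, ← integral_neg]
  simp only [hderiv]
  exact integral_congr_ae (.of_forall fun z => by ring)

theorem integral_dirDeriv_mollifier (v : E) : ∫ z, dirDeriv v (mollifier E) z = 0 := by
  simpa [dirDeriv] using integral_mul_dirDeriv_eq_neg (μ := volume) (f := fun _ => (1 : ℝ))
    contDiff_const (contDiff_mollifier (n := 1)) hasCompactSupport_mollifier v

variable (E) in
theorem exists_abs_dirDeriv_dirDeriv_moll_le :
    ∃ K : ℝ, 0 ≤ K ∧ ∀ u : E → ℝ, ContDiff ℝ 2 u → HasCompactSupport u → ∀ t, 0 < t →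
      ∀ v w x : E, |dirDeriv v (dirDeriv w (moll u t)) x| ≤
        K * ‖v‖ * ‖w‖ * (t⁻¹ * meanOsc (fderiv ℝ u) t x) := by
  have hρ : Continuous (fderiv ℝ (mollifier E)) :=
    (contDiff_mollifier (n := 1)).continuous_fderiv (by simp)
  have hρ_supp : HasCompactSupport (mollifier E) := hasCompactSupport_mollifier
  obtain ⟨K, hK⟩ := (hρ_supp.fderiv ℝ).exists_bound_of_continuous hρ
  have hK0 : 0 ≤ K := (norm_nonneg _).trans (hK 0)
  refine ⟨K * volume.real (closedBall (0 : E) 1), by positivity, fun u hu hu_supp t ht v w x => ?_⟩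
  have hu1 : ContDiff ℝ 1 u := hu.of_le one_le_two
  set b : E → E := fun z => dirDeriv v (mollifier E) z • w
  have hb : Continuous b := (hρ.clm_apply continuous_const).smul continuous_const
  have hb_supp (z : E) (hz : 1 ≤ ‖z‖) : b z = 0 := by
    simp [b, dirDeriv, fderiv_mollifier_eq_zero hz]
  have hb_int : ∫ z, b z = 0 := by
    rw [integral_smul_const, integral_dirDeriv_mollifier, zero_smul]
  have hb_le (z : E) : ‖b z‖ ≤ K * ‖v‖ * ‖w‖ := by
    rw [norm_smul]
    exact mul_le_mul_of_nonneg_right ((fderiv ℝ _ z).le_of_opNorm_le (hK z) v) (norm_nonneg w)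
  have h := abs_integral_comp_sub_smul_apply_le (hu1.continuous_fderiv one_ne_zero) hb hb_supp
    hb_int hb_le ht x
  have hD : t * dirDeriv v (dirDeriv w (moll u t)) x =
      ∫ z, fderiv ℝ u (x - t • z) (b z) := by
    rw [dirDeriv_moll hu1 hu_supp ht, mul_dirDeriv_moll
      (contDiff_dirDeriv hu (by norm_num) w) (hasCompactSupport_dirDeriv hu_supp w) ht]
    simp [b, dirDeriv, mul_comm]
  rw [← hD, abs_mul, abs_of_pos ht, ← le_inv_mul_iff₀ ht] at h
  exact h.trans_eq (by ring)

end MollificationBounds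

section ScaleMeasure

open Metric Set

variable {E G : Type*} [NormedAddCommGroup E] [InnerProductSpace ℝ E] [FiniteDimensional ℝ E]
  [MeasurableSpace E] [BorelSpace E] [NormedAddCommGroup G]

variable (E) in
/-- The measure `t ^ (-1 - s) dt dx` on the half-space of pairs (scale `t`, point `x`). Its `L^p`
norms of oscillations at scale `t` are dominated by the Gagliardo seminorm of order `s / p`. -/
noncomputable def scaleMeasure (s : ℝ) : Measure (ℝ × E) :=
  ((volume.restrict (Ioi 0)).withDensity fun t => ENNReal.ofReal (t ^ (-1 - s))).prod volume

theorem scaleMeasure_absolutelyContinuous (s : ℝ) :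
    scaleMeasure E s ≪ (volume.prod volume).restrict (Ioi 0 ×ˢ univ) := by
  have h : scaleMeasure E s ≪ (volume.restrict (Ioi (0 : ℝ))).prod (volume : Measure E) :=
    (withDensity_absolutelyContinuous _ _).prod .rfl
  rwa [← Measure.prod_restrict, Measure.restrict_univ]

theorem lintegral_scaleMeasure {s : ℝ} {f : ℝ × E → ℝ≥0∞} (hf : AEMeasurable f (scaleMeasure E s)) :
    ∫⁻ q, f q ∂scaleMeasure E s =
      ∫⁻ x, ∫⁻ t in Ioi 0, ENNReal.ofReal (t ^ (-1 - s)) * f (t, x) := by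
  rw [scaleMeasure, lintegral_prod_symm _ hf]
  exact lintegral_congr fun x => lintegral_withDensity_eq_lintegral_mul_non_measurable _
    (by fun_prop) (.of_forall fun _ => ENNReal.ofReal_lt_top) _

theorem lintegral_scaleMeasure_left {s : ℝ} {f : ℝ × E → ℝ≥0∞}
    (hf : AEMeasurable f (scaleMeasure E s)) :
    ∫⁻ q, f q ∂scaleMeasure E s =
      ∫⁻ t in Ioi 0, ENNReal.ofReal (t ^ (-1 - s)) * ∫⁻ x, f (t, x) := by
  rw [scaleMeasure, lintegral_prod _ hf]
  exact lintegral_withDensity_eq_lintegral_mul_non_measurable _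
    (by fun_prop) (.of_forall fun _ => ENNReal.ofReal_lt_top) _

theorem aemeasurable_meanOsc {F : E → G} (hF : Continuous F) (s : ℝ) :
    AEMeasurable (fun q : ℝ × E => ENNReal.ofReal (meanOsc F q.1 q.2)) (scaleMeasure E s) :=
  (((continuousOn_meanOsc hF).aemeasurable (measurableSet_Ioi.prod .univ)).mono_ac
    (scaleMeasure_absolutelyContinuous s)).ennreal_ofReal

theorem ofReal_meanOsc_rpow_le {F : E → G} (hF : Continuous F) {p : ℝ} (hp : 1 ≤ p) {t : ℝ}
    (ht : 0 < t) (x : E) :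
    ENNReal.ofReal (meanOsc F t x) ^ p ≤ ENNReal.ofReal (volume.real (closedBall x t))⁻¹ *
      ∫⁻ y in closedBall x t, ENNReal.ofReal (‖F x - F y‖ ^ p) := by
  have hp0 : 0 ≤ p := zero_le_one.trans hp
  have hpow_int : IntegrableOn (fun y => ‖F y - F x‖ ^ p) (closedBall x t) :=
    ContinuousOn.integrableOn_compact (isCompact_closedBall x t)
      (Continuous.rpow_const (by fun_prop) fun _ => .inr hp0).continuousOn
  have jensen : meanOsc F t x ^ p ≤ ⨍ y in closedBall x t, ‖F y - F x‖ ^ p :=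
    (convexOn_rpow hp).map_set_average_le (Real.continuous_rpow_const hp0).continuousOn isClosed_Ici
      (measure_closedBall_pos volume x ht).ne' measure_closedBall_lt_top.ne
      (.of_forall fun _ => norm_nonneg _)
      (ContinuousOn.integrableOn_compact (isCompact_closedBall x t) (by fun_prop)) hpow_int
  rw [ENNReal.ofReal_rpow_of_nonneg (meanOsc_nonneg F t x) hp0]
  refine (ENNReal.ofReal_le_ofReal jensen).trans_eq ?_
  rw [setAverage_eq, smul_eq_mul, ENNReal.ofReal_mul (by positivity),
    ofReal_integral_eq_lintegral_ofReal hpow_int (.of_forall fun _ => by positivity)]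
  simp only [norm_sub_rev]

theorem lintegral_Ici_rpow {a : ℝ} (ha : 0 < a) {r : ℝ} (hr : 0 < r) :
    ∫⁻ t in Ici r, ENNReal.ofReal (t ^ (-1 - a)) = ENNReal.ofReal (a⁻¹ * r ^ (-a)) := by
  have ha' : -1 - a < -1 := by linarith
  rw [setLIntegral_congr Ioi_ae_eq_Ici.symm, ← ofReal_integral_eq_lintegral_ofReal
    (integrableOn_Ioi_rpow_of_lt ha' hr), integral_Ioi_rpow_of_lt ha' hr]
  · rw [show -1 - a + 1 = -a by ring]
    field_simp
  · exact (ae_restrict_iff' measurableSet_Ioi).2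
      (.of_forall fun t ht => Real.rpow_nonneg (hr.trans ht).le _)

theorem lintegral_rpow_mul_setLIntegral_closedBall {a : ℝ} (ha : 0 < a) {g : E → ℝ≥0∞}
    (hg : Measurable g) {x : E} (hx : g x = 0) :
    ∫⁻ t in Ioi 0, ENNReal.ofReal (t ^ (-1 - a)) * ∫⁻ y in closedBall x t, g y =
      ∫⁻ y, ENNReal.ofReal (a⁻¹ * ‖x - y‖ ^ (-a)) * g y := by
  have hw : Measurable fun t : ℝ => ENNReal.ofReal (t ^ (-1 - a)) := by fun_prop
  set S : Set (ℝ × E) := {q | dist q.2 x ≤ q.1}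
  have hS : MeasurableSet S := (isClosed_le (by fun_prop) (by fun_prop)).measurableSet
  calc ∫⁻ t in Ioi 0, ENNReal.ofReal (t ^ (-1 - a)) * ∫⁻ y in closedBall x t, g y
      = ∫⁻ t in Ioi 0, ∫⁻ y,
          S.indicator (fun q => ENNReal.ofReal (q.1 ^ (-1 - a)) * g q.2) (t, y) := by
        refine lintegral_congr fun t => ?_
        rw [← lintegral_const_mul _ hg, ← lintegral_indicator measurableSet_closedBall]
        rfl
    _ = ∫⁻ y, ∫⁻ t in Ioi 0,
          S.indicator (fun q => ENNReal.ofReal (q.1 ^ (-1 - a)) * g q.2) (t, y) :=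
        lintegral_lintegral_swap <| AEMeasurable.indicator (by fun_prop) hS
    _ = ∫⁻ y, ENNReal.ofReal (a⁻¹ * ‖x - y‖ ^ (-a)) * g y := by
        refine lintegral_congr fun y => ?_
        rcases eq_or_ne y x with rfl | hy
        · simp [indicator, hx]
        have hr : 0 < ‖x - y‖ := norm_sub_pos_iff.2 hy.symm
        have hsection (t : ℝ) : S.indicator (fun q => ENNReal.ofReal (q.1 ^ (-1 - a)) * g q.2)
            (t, y) = (Ici ‖x - y‖).indicator (fun t => ENNReal.ofReal (t ^ (-1 - a)) * g y) t := by
          simp only [S, indicator, mem_ofPred_eq, mem_Ici, ← dist_eq_norm, dist_comm y x]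
        simp only [hsection]
        rw [setLIntegral_indicator measurableSet_Ici, inter_eq_left.2 (Ici_subset_Ioi.2 hr),
          lintegral_mul_const _ hw, lintegral_Ici_rpow ha hr]

theorem lintegral_meanOsc_rpow_le {F : E → G} (hF : Continuous F) {p s : ℝ} (hp : 1 ≤ p)
    (hs : 0 < Module.finrank ℝ E + s) :
    ∫⁻ q, ENNReal.ofReal (meanOsc F q.1 q.2) ^ p ∂scaleMeasure E s ≤
      ENNReal.ofReal (volume.real (closedBall (0 : E) 1) * (Module.finrank ℝ E + s))⁻¹ *
        ∫⁻ x, ∫⁻ y, ENNReal.ofReal (‖F x - F y‖ ^ p / ‖x - y‖ ^ (Module.finrank ℝ E + s)) := by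
  set V := volume.real (closedBall (0 : E) 1)
  set d := Module.finrank ℝ E
  have hV : 0 ≤ V := measureReal_nonneg
  have hp0 : 0 < p := zero_lt_one.trans_le hp
  have hpow (x : E) : Measurable fun y => ENNReal.ofReal (‖F x - F y‖ ^ p) :=
    (Continuous.rpow_const (by fun_prop) fun _ => .inr hp0.le).measurable.ennreal_ofReal
  have hweight {t : ℝ} (ht : 0 < t) (x : E) :
      t ^ (-1 - s) * (volume.real (closedBall x t))⁻¹ = V⁻¹ * t ^ (-1 - (d + s)) := by
    rw [Measure.addHaar_real_closedBall' volume x ht.le, mul_inv, ← Real.rpow_natCast,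
      ← Real.rpow_neg ht.le, ← mul_assoc, ← Real.rpow_add ht, mul_comm, ← sub_eq_add_neg,
      sub_sub, add_comm s]
  rw [lintegral_scaleMeasure ((aemeasurable_meanOsc hF s).pow_const p),
    ← lintegral_const_mul' _ _ ENNReal.ofReal_ne_top]
  refine lintegral_mono fun x => ?_
  calc ∫⁻ t in Ioi 0, ENNReal.ofReal (t ^ (-1 - s)) * ENNReal.ofReal (meanOsc F t x) ^ p
      ≤ ∫⁻ t in Ioi 0, ENNReal.ofReal V⁻¹ * (ENNReal.ofReal (t ^ (-1 - (d + s))) *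
          ∫⁻ y in closedBall x t, ENNReal.ofReal (‖F x - F y‖ ^ p)) := by
        refine setLIntegral_mono' measurableSet_Ioi fun t ht => ?_
        rw [← mul_assoc, ← ENNReal.ofReal_mul (inv_nonneg.2 hV), ← hweight ht x,
          ENNReal.ofReal_mul (Real.rpow_nonneg (le_of_lt ht) _), mul_assoc]
        gcongr
        exact ofReal_meanOsc_rpow_le hF hp ht x
    _ = ENNReal.ofReal V⁻¹ * ∫⁻ y, ENNReal.ofReal ((d + s)⁻¹ * ‖x - y‖ ^ (-(d + s))) *
          ENNReal.ofReal (‖F x - F y‖ ^ p) := by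
        rw [lintegral_const_mul' _ _ ENNReal.ofReal_ne_top,
          lintegral_rpow_mul_setLIntegral_closedBall hs (hpow x) (by simp [hp0.ne'])]
    _ = _ := by
        rw [← lintegral_const_mul' _ _ ENNReal.ofReal_ne_top,
          ← lintegral_const_mul' _ _ ENNReal.ofReal_ne_top]
        refine lintegral_congr fun y => ?_
        rw [← ENNReal.ofReal_mul (by positivity), ← ENNReal.ofReal_mul (by positivity),
          ← ENNReal.ofReal_mul (by positivity), Real.rpow_neg (norm_nonneg _), mul_inv]
        congr 1
        ring

end ScaleMeasure

section Holder

theorem lintegral_mul_add_pow_le {α : Type*} [MeasurableSpace α] {μ : Measure α} (n : ℕ)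
    {f g h : α → ℝ≥0∞} (hf : AEMeasurable f μ) (hg : AEMeasurable g μ) (hh : AEMeasurable h μ) :
    ∫⁻ a, f a * (g a + h a) ^ n ∂μ ≤
      (∫⁻ a, f a ^ (n + 1 : ℝ) ∂μ) ^ (1 / (n + 1 : ℝ)) *
        ((∫⁻ a, g a ^ (n + 1 : ℝ) ∂μ) ^ (1 / (n + 1 : ℝ)) +
          (∫⁻ a, h a ^ (n + 1 : ℝ) ∂μ) ^ (1 / (n + 1 : ℝ))) ^ n := by
  have hn : (0 : ℝ) < n + 1 := by positivity
  have hpow (r : ℝ≥0∞) : (r ^ (n + 1 : ℝ)) ^ (n / (n + 1) : ℝ) = r ^ n := by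
    rw [← ENNReal.rpow_mul, mul_div_cancel₀ _ hn.ne', ENNReal.rpow_natCast]
  calc ∫⁻ a, f a * (g a + h a) ^ n ∂μ
      = ∫⁻ a, (f a ^ (n + 1 : ℝ)) ^ (1 / (n + 1) : ℝ) *
          ((g a + h a) ^ (n + 1 : ℝ)) ^ (n / (n + 1) : ℝ) ∂μ := by
        simp only [hpow, one_div, ENNReal.rpow_rpow_inv hn.ne']
    _ ≤ (∫⁻ a, f a ^ (n + 1 : ℝ) ∂μ) ^ (1 / (n + 1) : ℝ) *
          (∫⁻ a, (g a + h a) ^ (n + 1 : ℝ) ∂μ) ^ (n / (n + 1) : ℝ) :=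
        ENNReal.lintegral_mul_norm_pow_le (hf.pow_const _) ((hg.add hh).pow_const _)
          (by positivity) (by positivity) (by field_simp; ring)
    _ = (∫⁻ a, f a ^ (n + 1 : ℝ) ∂μ) ^ (1 / (n + 1) : ℝ) *
          ((∫⁻ a, (g a + h a) ^ (n + 1 : ℝ) ∂μ) ^ (1 / (n + 1) : ℝ)) ^ n := by
        rw [← ENNReal.rpow_mul_natCast, one_div_mul_eq_div]
    _ ≤ _ := by
        gcongr
        exact ENNReal.lintegral_Lp_add_le hg hh (by simp)

end Holder

section ParametricIntegral

open Set

theorem enorm_le_lintegral_enorm_of_hasDerivAt {F : Type*} [NormedAddCommGroup F] [NormedSpace ℝ F]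
    [CompleteSpace F] {f f' : ℝ → F} {a : ℝ} (hcont : ContinuousWithinAt f (Ici a) a)
    (hderiv : ∀ t ∈ Ioi a, HasDerivAt f (f' t) t)
    (hlim : Filter.Tendsto f Filter.atTop (nhds 0)) :
    ‖f a‖ₑ ≤ ∫⁻ t in Ioi a, ‖f' t‖ₑ := by
  rcases eq_or_ne (∫⁻ t in Ioi a, ‖f' t‖ₑ) ∞ with htop | hfin
  · exact htop ▸ le_top
  have hmeas : AEStronglyMeasurable f' (volume.restrict (Ioi a)) :=
    (aestronglyMeasurable_deriv f _).congr <|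
      (ae_restrict_iff' measurableSet_Ioi).2 (.of_forall fun t ht => (hderiv t ht).deriv)
  have hint : IntegrableOn f' (Ioi a) := ⟨hmeas, hfin.lt_top⟩
  have hftc := integral_Ioi_of_hasDerivAt_of_tendsto hcont hderiv hint hlim
  rw [← enorm_neg, ← zero_sub, ← hftc]
  exact enorm_integral_le_lintegral_enorm _

variable {E : Type*} [NormedAddCommGroup E] [NormedSpace ℝ E] [MeasurableSpace E]
  [OpensMeasurableSpace E] {μ : Measure E} [IsFiniteMeasureOnCompacts μ]

theorem hasDerivAt_integral_mul_of_contDiffOn {H : ℝ × E → ℝ}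
    (hH : ContDiffOn ℝ 1 H (Ioi 0 ×ˢ univ)) {φ : E → ℝ} (hφ : Continuous φ)
    (hφ_supp : HasCompactSupport φ) {t : ℝ} (ht : 0 < t) :
    HasDerivAt (fun s => ∫ x, H (s, x) * φ x ∂μ)
      (∫ x, dirDeriv ((1 : ℝ), (0 : E)) H (t, x) * φ x ∂μ) t := by
  have hH' : ContinuousOn (dirDeriv ((1 : ℝ), (0 : E)) H) (Ioi 0 ×ˢ univ) :=
    (contDiffOn_dirDeriv (m := 0) hH (isOpen_Ioi.prod isOpen_univ) (by simp) _).continuousOn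
  have hslice {G : ℝ × E → ℝ} (hG : ContinuousOn G (Ioi 0 ×ˢ univ)) {s : ℝ} (hs : 0 < s) :
      Continuous fun x => G (s, x) * φ x :=
    (hG.comp_continuous (f := fun x => (s, x)) (by fun_prop) fun x => ⟨hs, mem_univ x⟩).mul hφ
  have hnhds : Icc (t / 2) (2 * t) ∈ nhds t := Icc_mem_nhds (half_lt_self ht) (by linarith)
  have hpos : ∀ s ∈ Icc (t / 2) (2 * t), 0 < s := fun s hs => (half_pos ht).trans_le hs.1
  obtain ⟨C, hC⟩ := (isCompact_Icc.prod hφ_supp).exists_bound_of_continuousOn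
    (hH'.mono fun q hq => ⟨hpos q.1 hq.1, mem_univ q.2⟩)
  refine (hasDerivAt_integral_of_dominated_loc_of_deriv_le (F := fun s x => H (s, x) * φ x)
    (F' := fun s x => dirDeriv ((1 : ℝ), (0 : E)) H (s, x) * φ x) (bound := fun x => C * |φ x|)
    hnhds ?_ ?_ ?_ ?_ ?_ ?_).2
  · filter_upwards [Ioi_mem_nhds ht] with s hs
    exact (hslice hH.continuousOn hs).aestronglyMeasurable
  · exact (hslice hH.continuousOn ht).integrable_of_hasCompactSupport hφ_supp.mul_left
  · exact (hslice hH' ht).aestronglyMeasurable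
  · refine .of_forall fun x s hs => ?_
    rw [norm_mul, Real.norm_eq_abs (φ x)]
    by_cases hx : x ∈ tsupport φ
    · exact mul_le_mul_of_nonneg_right (hC (s, x) ⟨hs, hx⟩) (abs_nonneg _)
    · simp [image_eq_zero_of_notMem_tsupport hx]
  · exact (hφ.integrable_of_hasCompactSupport hφ_supp).abs.const_mul C
  · refine .of_forall fun x s hs => (hasDerivAt_dirDeriv_one_zero ?_).mul_const _
    exact (hH.differentiableOn one_ne_zero).differentiableAt
      (Ioi_prod_univ_mem_nhds (hpos s hs) x)

end ParametricIntegral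

section CompactSupport

variable {E F : Type*} [NormedAddCommGroup E] [NormedSpace ℝ E] [NormedAddCommGroup F]
  [NormedSpace ℝ F] {f : E → F}

theorem exists_norm_fderiv_le (hf : ContDiff ℝ 1 f) (hf_supp : HasCompactSupport f) :
    ∃ M : ℝ, ∀ x, ‖fderiv ℝ f x‖ ≤ M :=
  (hf_supp.fderiv ℝ).exists_bound_of_continuous (hf.continuous_fderiv one_ne_zero)

theorem exists_norm_fderiv_fderiv_le (hf : ContDiff ℝ 2 f) (hf_supp : HasCompactSupport f) :
    ∃ M : ℝ, ∀ x, ‖fderiv ℝ (fderiv ℝ f) x‖ ≤ M :=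
  exists_norm_fderiv_le (hf.fderiv_right (by norm_num)) (hf_supp.fderiv ℝ)

end CompactSupport

section MollifiedHessian

open Set

variable {N : ℕ} {u φ : EuclideanSpace ℝ (Fin N) → ℝ}

theorem continuous_hessianMatrix (hu : ContDiff ℝ 2 u) (i j : Fin N) :
    Continuous fun x => hessianMatrix u x i j :=
  (contDiff_hessianMatrix (m := 0) hu (by simp) i j).continuous

theorem abs_hessianMatrix_le_norm (u : EuclideanSpace ℝ (Fin N) → ℝ) (x : EuclideanSpace ℝ (Fin N))
    (i j : Fin N) : |hessianMatrix u x i j| ≤ ‖fderiv ℝ (fderiv ℝ u) x‖ := by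
  simpa [hessianMatrix] using (fderiv ℝ (fderiv ℝ u) x).le_opNorm₂ (stdVec i) (stdVec j)

theorem hessianMatrix_moll (hu : ContDiff ℝ 2 u) (hu_supp : HasCompactSupport u) {t : ℝ}
    (ht : 0 ≤ t) (x : EuclideanSpace ℝ (Fin N)) (i j : Fin N) :
    hessianMatrix (moll u t) x i j = moll (fun y => hessianMatrix u y i j) t x := by
  rcases ht.eq_or_lt with rfl | ht
  · rw [moll_zero, funext (moll_zero u)]
  have hentry : (fun y => hessianMatrix u y i j) = dirDeriv (stdVec i) (dirDeriv (stdVec j) u) :=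
    funext fun y => hessianMatrix_apply_eq_dirDeriv hu.contDiffAt i j
  rw [hessianMatrix_apply_eq_dirDeriv (contDiff_moll (n := 2) hu.continuous ht).contDiffAt, hentry,
    dirDeriv_moll (hu.of_le one_le_two) hu_supp ht, dirDeriv_moll
      (contDiff_dirDeriv hu (by norm_num) _) (hasCompactSupport_dirDeriv hu_supp _) ht]

theorem hessianMatrix_mollTime (hu : ContDiff ℝ 2 u) (hu_supp : HasCompactSupport u) {t : ℝ}
    (ht : 0 < t) (x : EuclideanSpace ℝ (Fin N)) (i j : Fin N) :
    hessianMatrix (mollTime u t) x i j = mollTime (fun y => hessianMatrix u y i j) t x := by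
  have hentry : (fun y => hessianMatrix u y i j) = dirDeriv (stdVec i) (dirDeriv (stdVec j) u) :=
    funext fun y => hessianMatrix_apply_eq_dirDeriv hu.contDiffAt i j
  rw [hessianMatrix_apply_eq_dirDeriv (contDiff_mollTime (n := 2) hu.continuous ht).contDiffAt,
    hentry, dirDeriv_mollTime (hu.of_le one_le_two) hu_supp ht, dirDeriv_mollTime
      (contDiff_dirDeriv hu (by norm_num) _) (hasCompactSupport_dirDeriv hu_supp _) ht]

theorem hasDerivAt_hessianMatrix_moll (hu : ContDiff ℝ 2 u) (hu_supp : HasCompactSupport u)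
    {t : ℝ} (ht : 0 < t) (x : EuclideanSpace ℝ (Fin N)) (i j : Fin N) :
    HasDerivAt (fun s => hessianMatrix (moll u s) x i j)
      (hessianMatrix (mollTime u t) x i j) t := by
  rw [hessianMatrix_mollTime hu hu_supp ht]
  refine (hasDerivAt_moll (continuous_hessianMatrix hu i j) ht x).congr_of_eventuallyEq ?_
  filter_upwards [Ioi_mem_nhds ht] with s hs using hessianMatrix_moll hu hu_supp hs.le x i j

theorem continuousOn_det_hessianMatrix_moll (hu : ContDiff ℝ 2 u) (hu_supp : HasCompactSupport u) :
    ContinuousOn (fun q : ℝ × EuclideanSpace ℝ (Fin N) => (hessianMatrix (moll u q.1) q.2).det)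
      (Ici 0 ×ˢ univ) := by
  obtain ⟨M, hM⟩ := exists_norm_fderiv_fderiv_le hu hu_supp
  refine contDiffOn_zero.1 (contDiffOn_det fun i j => contDiffOn_zero.2 ?_)
  exact (continuous_moll (continuous_hessianMatrix hu i j)
    fun x => (abs_hessianMatrix_le_norm u x i j).trans (hM x)).continuousOn.congr
    fun q hq => hessianMatrix_moll hu hu_supp hq.1 q.2 i j

theorem contDiffOn_det_hessianMatrix_moll (hu : ContDiff ℝ 2 u) (hu_supp : HasCompactSupport u) :
    ContDiffOn ℝ 1 (fun q : ℝ × EuclideanSpace ℝ (Fin N) => (hessianMatrix (moll u q.1) q.2).det)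
      (Ioi 0 ×ˢ univ) :=
  contDiffOn_det fun i j =>
    ((contDiffOn_moll (continuous_hessianMatrix hu i j)).of_le (by simp)).congr
      fun q hq => hessianMatrix_moll hu hu_supp (le_of_lt hq.1) q.2 i j

/-- The density of `d/dt ∫ det (D²uₜ) φ`, where `uₜ` is the mollification of `u` at scale `t`, with
all derivatives except those forming the cofactors of `D²uₜ` moved onto `φ`. -/
noncomputable def hessianDetFlux (u φ : EuclideanSpace ℝ (Fin N) → ℝ) (t : ℝ)
    (x : EuclideanSpace ℝ (Fin N)) : ℝ :=
  mollTime u t x * ((hessianMatrix (moll u t) x).adjugate * hessianMatrix φ x).trace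

theorem hasDerivAt_integral_det_hessianMatrix_moll (hu : ContDiff ℝ 2 u)
    (hu_supp : HasCompactSupport u) (hφ : ContDiff ℝ 2 φ) (hφ_supp : HasCompactSupport φ) {t : ℝ}
    (ht : 0 < t) :
    HasDerivAt (fun s => ∫ x, (hessianMatrix (moll u s) x).det * φ x)
      (∫ x, hessianDetFlux u φ t x) t := by
  have hsmooth := contDiffOn_det_hessianMatrix_moll hu hu_supp
  have hjacobi (x : EuclideanSpace ℝ (Fin N)) :
      dirDeriv ((1 : ℝ), 0) (fun q => (hessianMatrix (moll u q.1) q.2).det) (t, x) =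
        ((hessianMatrix (moll u t) x).adjugate * hessianMatrix (mollTime u t) x).trace :=
    (hasDerivAt_dirDeriv_one_zero ((hsmooth.differentiableOn one_ne_zero).differentiableAt
      (Ioi_prod_univ_mem_nhds ht x))).unique
      (hasDerivAt_det (hasDerivAt_hessianMatrix_moll hu hu_supp ht x))
  have h := hasDerivAt_integral_mul_of_contDiffOn (μ := volume) hsmooth hφ.continuous hφ_supp ht
  simp only [hjacobi] at h
  rwa [integral_trace_adjugate_mul_hessianMatrix_mul (contDiff_moll (n := 3) hu.continuous ht)
    (contDiff_mollTime (n := 2) hu.continuous ht) hφ hφ_supp] at h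

theorem continuousOn_integral_det_hessianMatrix_moll (hu : ContDiff ℝ 2 u)
    (hu_supp : HasCompactSupport u) (hφ : Continuous φ) (hφ_supp : HasCompactSupport φ) :
    ContinuousOn (fun t => ∫ x, (hessianMatrix (moll u t) x).det * φ x) (Ici 0) :=
  continuousOn_integral_of_compact_support hφ_supp
    ((continuousOn_det_hessianMatrix_moll hu hu_supp).mul (by fun_prop))
    fun t x _ hx => by rw [image_eq_zero_of_notMem_tsupport hx, mul_zero]

theorem exists_abs_hessianMatrix_moll_le (N : ℕ) :
    ∃ K : ℝ, 0 ≤ K ∧ ∀ u : EuclideanSpace ℝ (Fin N) → ℝ, ContDiff ℝ 2 u → HasCompactSupport u →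
      ∀ t, 0 < t → ∀ x i j,
        |hessianMatrix (moll u t) x i j| ≤ K * (t⁻¹ * meanOsc (fderiv ℝ u) t x) := by
  obtain ⟨K, hK0, hK⟩ := exists_abs_dirDeriv_dirDeriv_moll_le (EuclideanSpace ℝ (Fin N))
  refine ⟨K, hK0, fun u hu hu_supp t ht x i j => ?_⟩
  rw [hessianMatrix_apply_eq_dirDeriv (contDiff_moll (n := 2) hu.continuous ht).contDiffAt]
  simpa using hK u hu hu_supp t ht (stdVec i) (stdVec j) x

theorem tendsto_integral_det_hessianMatrix_moll_atTop (hN : N ≠ 0) (hu : ContDiff ℝ 2 u)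
    (hu_supp : HasCompactSupport u) (hφ : Continuous φ) (hφ_supp : HasCompactSupport φ) :
    Filter.Tendsto (fun t => ∫ x, (hessianMatrix (moll u t) x).det * φ x) Filter.atTop
      (nhds 0) := by
  obtain ⟨K, hK0, hK⟩ := exists_abs_hessianMatrix_moll_le N
  obtain ⟨M, hM⟩ := exists_norm_fderiv_le (hu.of_le one_le_two) hu_supp
  have hdet {t : ℝ} (ht : 0 < t) (x : EuclideanSpace ℝ (Fin N)) :
      |(hessianMatrix (moll u t) x).det| ≤ N.factorial • (K * (t⁻¹ * (2 * M))) ^ N := by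
    simpa using Matrix.det_le (abv := .abs) fun i j => (hK u hu hu_supp t ht x i j).trans <| by
      gcongr
      exact meanOsc_le hM ht x
  have hzero : Filter.Tendsto (fun t : ℝ => N.factorial • (K * (t⁻¹ * (2 * M))) ^ N * ∫ x, |φ x|)
      Filter.atTop (nhds 0) := by
    simpa [hN] using ((((tendsto_inv_atTop_zero.mul_const (2 * M)).const_mul K).pow N).const_smul
      N.factorial).mul_const (∫ x, |φ x|)
  refine squeeze_zero_norm' ?_ hzero
  filter_upwards [Filter.eventually_gt_atTop 0] with t ht
  rw [← integral_const_mul]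
  refine norm_integral_le_of_norm_le
    ((hφ.integrable_of_hasCompactSupport hφ_supp).abs.const_mul _) (.of_forall fun x => ?_)
  rw [norm_mul]
  exact mul_le_mul_of_nonneg_right (hdet ht x) (abs_nonneg _)

end MollifiedHessian

section FluxEstimate

open Set

variable {N : ℕ} {u u₁ u₂ φ : EuclideanSpace ℝ (Fin N) → ℝ}

theorem exists_abs_mollTime_and_hessianMatrix_moll_le (N : ℕ) :
    ∃ K : ℝ, 0 ≤ K ∧ ∀ u : EuclideanSpace ℝ (Fin N) → ℝ, ContDiff ℝ 2 u → HasCompactSupport u →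
      ∀ t, 0 < t → ∀ x,
        |t⁻¹ * mollTime u t x| ≤ K * (t⁻¹ * meanOsc (fderiv ℝ u) t x) ∧
          ∀ i j, |hessianMatrix (moll u t) x i j| ≤ K * (t⁻¹ * meanOsc (fderiv ℝ u) t x) := by
  obtain ⟨K₀, hK₀, htime⟩ := exists_abs_mollTime_le (EuclideanSpace ℝ (Fin N))
  obtain ⟨K₁, -, hhess⟩ := exists_abs_hessianMatrix_moll_le N
  refine ⟨max K₀ K₁, hK₀.trans (le_max_left _ _), fun u hu hu_supp t ht x => ?_⟩
  have hosc := meanOsc_nonneg (fderiv ℝ u) t x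
  constructor
  · rw [abs_mul, abs_of_pos (inv_pos.2 ht), mul_left_comm]
    gcongr
    exact (htime u (hu.of_le one_le_two) hu_supp t ht x).trans (by gcongr; exact le_max_left _ _)
  · exact fun i j => (hhess u hu hu_supp t ht x i j).trans (by gcongr; exact le_max_right _ _)

theorem exists_abs_hessianDetFlux_sub_le (N : ℕ) :
    ∃ C : ℝ, 0 ≤ C ∧ ∀ u₁ u₂ φ : EuclideanSpace ℝ (Fin N) → ℝ,
      ContDiff ℝ 2 u₁ → HasCompactSupport u₁ → ContDiff ℝ 2 u₂ → HasCompactSupport u₂ →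
      ∀ t, 0 < t → ∀ x H, (∀ i j, |hessianMatrix φ x i j| ≤ H) →
        |hessianDetFlux u₁ φ t x - hessianDetFlux u₂ φ t x| ≤
          C * H * (t⁻¹ ^ (N - 1) * (meanOsc (fderiv ℝ (u₁ - u₂)) t x *
            (meanOsc (fderiv ℝ u₁) t x + meanOsc (fderiv ℝ u₂) t x) ^ (N - 1))) := by
  obtain ⟨K, hK0, hK⟩ := exists_abs_mollTime_and_hessianMatrix_moll_le N
  refine ⟨N ^ 2 * (‖detRowCMM (Fin N)‖ * N * K ^ (N - 1) * K), by positivity, ?_⟩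
  intro u₁ u₂ φ hu₁ hu₁_supp hu₂ hu₂_supp t ht x H hH
  obtain ⟨htime₁, hhess₁⟩ := hK u₁ hu₁ hu₁_supp t ht x
  obtain ⟨htime₂, hhess₂⟩ := hK u₂ hu₂ hu₂_supp t ht x
  obtain ⟨htime, hhess⟩ := hK (u₁ - u₂) (hu₁.sub hu₂) (hu₁_supp.sub hu₂_supp) t ht x
  rw [mollTime_sub hu₁.continuous hu₂.continuous ht, mul_sub] at htime
  rw [moll_sub hu₁.continuous hu₂.continuous, hessianMatrix_sub
    (contDiff_moll (n := 2) hu₁.continuous ht) (contDiff_moll (n := 2) hu₂.continuous ht)] at hhess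
  have ho₁ := meanOsc_nonneg (fderiv ℝ u₁) t x
  have ho₂ := meanOsc_nonneg (fderiv ℝ u₂) t x
  set o₁ := meanOsc (fderiv ℝ u₁) t x
  set o₂ := meanOsc (fderiv ℝ u₂) t x
  have hle₁ : K * (t⁻¹ * o₁) ≤ K * (t⁻¹ * (o₁ + o₂)) := by gcongr; exact le_add_of_nonneg_right ho₂
  have hle₂ : K * (t⁻¹ * o₂) ≤ K * (t⁻¹ * (o₁ + o₂)) := by gcongr; exact le_add_of_nonneg_left ho₁
  -- The factor `t⁻¹` puts `∂ₜuₜ` on the same scale as `D²uₜ`.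
  have hbound := abs_mul_trace_adjugate_mul_sub_le (htime₁.trans hle₁) (htime₂.trans hle₂) htime
    (fun i j => (hhess₁ i j).trans hle₁) (fun i j => (hhess₂ i j).trans hle₂) hhess hH
  rw [mul_assoc, mul_assoc, ← mul_sub, abs_mul, abs_of_pos (inv_pos.2 ht), Fintype.card_fin]
    at hbound
  refine ((inv_mul_le_iff₀ ht).1 hbound).trans_eq ?_
  rw [mul_pow, mul_pow]
  field_simp

theorem integrable_hessianDetFlux (hu : Continuous u) (hφ : ContDiff ℝ 2 φ)
    (hφ_supp : HasCompactSupport φ) {t : ℝ} (ht : 0 < t) :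
    Integrable (hessianDetFlux u φ t) := by
  have hcont {v : EuclideanSpace ℝ (Fin N) → ℝ} (hv : ContDiff ℝ 2 v) :
      Continuous (hessianMatrix v) := continuous_matrix (continuous_hessianMatrix hv)
  have htrace : Continuous fun x =>
      ((hessianMatrix (moll u t) x).adjugate * hessianMatrix φ x).trace :=
    ((hcont (contDiff_moll (n := 2) hu ht)).matrix_adjugate.matrix_mul (hcont hφ)).matrix_trace
  refine ((contDiff_mollTime (n := 0) hu ht).continuous.mul htrace).integrable_of_hasCompactSupport
    (.intro hφ_supp fun x hx => ?_)
  have hzero : fderiv ℝ (fderiv ℝ φ) x = 0 := image_eq_zero_of_notMem_tsupport fun h =>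
    hx (tsupport_fderiv_subset ℝ (tsupport_fderiv_subset ℝ h))
  have hhess : hessianMatrix φ x = 0 := by ext i j; simp [hessianMatrix, hzero]
  simp [hhess]

theorem enorm_integral_det_sub_det_mul_le (hN : N ≠ 0) (hu₁ : ContDiff ℝ 2 u₁)
    (hu₁_supp : HasCompactSupport u₁) (hu₂ : ContDiff ℝ 2 u₂) (hu₂_supp : HasCompactSupport u₂)
    (hφ : ContDiff ℝ 2 φ) (hφ_supp : HasCompactSupport φ) :
    ‖∫ x, ((hessianMatrix u₁ x).det - (hessianMatrix u₂ x).det) * φ x‖ₑ ≤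
      ∫⁻ t in Ioi 0, ∫⁻ x, ‖hessianDetFlux u₁ φ t x - hessianDetFlux u₂ φ t x‖ₑ := by
  set I : (EuclideanSpace ℝ (Fin N) → ℝ) → ℝ → ℝ :=
    fun u t => ∫ x, (hessianMatrix (moll u t) x).det * φ x
  have hint {u : EuclideanSpace ℝ (Fin N) → ℝ} (hu : ContDiff ℝ 2 u) :
      Integrable fun x => (hessianMatrix u x).det * φ x :=
    ((continuous_matrix (continuous_hessianMatrix hu)).matrix_det.mul
      hφ.continuous).integrable_of_hasCompactSupport hφ_supp.mul_left
  have hzero : I u₁ 0 - I u₂ 0 =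
      ∫ x, ((hessianMatrix u₁ x).det - (hessianMatrix u₂ x).det) * φ x := by
    simp only [I, funext (moll_zero _), sub_mul]
    exact (integral_sub (hint hu₁) (hint hu₂)).symm
  have hcont : ContinuousOn (fun t => I u₁ t - I u₂ t) (Ici 0) :=
    (continuousOn_integral_det_hessianMatrix_moll hu₁ hu₁_supp hφ.continuous hφ_supp).sub
      (continuousOn_integral_det_hessianMatrix_moll hu₂ hu₂_supp hφ.continuous hφ_supp)
  have hlim : Filter.Tendsto (fun t => I u₁ t - I u₂ t) Filter.atTop (nhds 0) := by
    simpa using (tendsto_integral_det_hessianMatrix_moll_atTop hN hu₁ hu₁_supp hφ.continuous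
      hφ_supp).sub (tendsto_integral_det_hessianMatrix_moll_atTop hN hu₂ hu₂_supp hφ.continuous
      hφ_supp)
  rw [← hzero]
  refine (enorm_le_lintegral_enorm_of_hasDerivAt (hcont 0 self_mem_Ici) (fun t ht =>
    (hasDerivAt_integral_det_hessianMatrix_moll hu₁ hu₁_supp hφ hφ_supp ht).sub
      (hasDerivAt_integral_det_hessianMatrix_moll hu₂ hu₂_supp hφ hφ_supp ht)) hlim).trans ?_
  refine setLIntegral_mono' measurableSet_Ioi fun t ht => ?_
  rw [← integral_sub (integrable_hessianDetFlux hu₁.continuous hφ hφ_supp ht)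
    (integrable_hessianDetFlux hu₂.continuous hφ hφ_supp ht)]
  exact enorm_integral_le_lintegral_enorm _

end FluxEstimate

section BesovEstimate

open Set

variable {N : ℕ} {u u₁ u₂ φ : EuclideanSpace ℝ (Fin N) → ℝ}

theorem lintegral_meanOsc_fderiv_rpow_le (hu : ContDiff ℝ 1 u) {σ p : ℝ} (hp : 1 ≤ p)
    (hσ : 0 < N + σ * p) :
    (∫⁻ q, ENNReal.ofReal (meanOsc (fderiv ℝ u) q.1 q.2) ^ p
        ∂scaleMeasure (EuclideanSpace ℝ (Fin N)) (σ * p)) ^ (1 / p) ≤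
      ENNReal.ofReal (volume.real (Metric.closedBall (0 : EuclideanSpace ℝ (Fin N)) 1) *
        (N + σ * p))⁻¹ ^ (1 / p) * gagliardoESeminormDeriv σ p u := by
  have hp' : 0 ≤ 1 / p := by positivity
  have h := lintegral_meanOsc_rpow_le (hu.continuous_fderiv one_ne_zero) hp (s := σ * p)
    (by simpa using hσ)
  rw [finrank_euclideanSpace_fin] at h
  rw [gagliardoESeminormDeriv, ← ENNReal.mul_rpow_of_nonneg _ _ hp']
  gcongr

theorem lintegral_meanOsc_fderiv_mul_pow_le (hN : N ≠ 0) (hu₁ : ContDiff ℝ 1 u₁)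
    (hu₂ : ContDiff ℝ 1 u₂) {σ : ℝ} (hσ : 0 < N + σ * N) :
    ∫⁻ q, ENNReal.ofReal (meanOsc (fderiv ℝ (u₁ - u₂)) q.1 q.2) *
        (ENNReal.ofReal (meanOsc (fderiv ℝ u₁) q.1 q.2) +
          ENNReal.ofReal (meanOsc (fderiv ℝ u₂) q.1 q.2)) ^ (N - 1)
        ∂scaleMeasure (EuclideanSpace ℝ (Fin N)) (σ * N) ≤
      ENNReal.ofReal (volume.real (Metric.closedBall (0 : EuclideanSpace ℝ (Fin N)) 1) *
        (N + σ * N))⁻¹ * (gagliardoESeminormDeriv σ N (u₁ - u₂) *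
          (gagliardoESeminormDeriv σ N u₁ + gagliardoESeminormDeriv σ N u₂) ^ (N - 1)) := by
  have hN1 : (1 : ℝ) ≤ N := by exact_mod_cast Nat.one_le_iff_ne_zero.2 hN
  have hpred : ((N - 1 : ℕ) : ℝ) + 1 = N := by exact_mod_cast Nat.sub_one_add_one hN
  have hmeas {u : EuclideanSpace ℝ (Fin N) → ℝ} (hu : ContDiff ℝ 1 u) :=
    aemeasurable_meanOsc (hu.continuous_fderiv one_ne_zero) (σ * N)
  have hHolder := lintegral_mul_add_pow_le (N - 1) (hmeas (hu₁.sub hu₂)) (hmeas hu₁) (hmeas hu₂)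
  rw [hpred] at hHolder
  set c := ENNReal.ofReal (volume.real (Metric.closedBall (0 : EuclideanSpace ℝ (Fin N)) 1) *
    (N + σ * N))⁻¹
  have hc : c ^ (1 / N : ℝ) * (c ^ (1 / N : ℝ)) ^ (N - 1) = c := by
    rw [mul_pow_sub_one hN, ← ENNReal.rpow_natCast, ← ENNReal.rpow_mul,
      one_div_mul_cancel (by positivity), ENNReal.rpow_one]
  calc _ ≤ _ := hHolder
    _ ≤ c ^ (1 / N : ℝ) * gagliardoESeminormDeriv σ N (u₁ - u₂) *
        (c ^ (1 / N : ℝ) * gagliardoESeminormDeriv σ N u₁ +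
          c ^ (1 / N : ℝ) * gagliardoESeminormDeriv σ N u₂) ^ (N - 1) := by
      gcongr
      exacts [lintegral_meanOsc_fderiv_rpow_le (hu₁.sub hu₂) hN1 hσ,
        lintegral_meanOsc_fderiv_rpow_le hu₁ hN1 hσ, lintegral_meanOsc_fderiv_rpow_le hu₂ hN1 hσ]
    _ = _ := by rw [← mul_add, mul_pow, mul_mul_mul_comm, hc]

theorem exists_lintegral_enorm_hessianDetFlux_sub_le (hN : N ≠ 0) :
    ∃ C : ℝ, 0 ≤ C ∧ ∀ u₁ u₂ φ : EuclideanSpace ℝ (Fin N) → ℝ,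
      ContDiff ℝ 2 u₁ → HasCompactSupport u₁ → ContDiff ℝ 2 u₂ → HasCompactSupport u₂ →
      ∀ H, (∀ i j x, |hessianMatrix φ x i j| ≤ H) →
        ∫⁻ t in Ioi 0, ∫⁻ x, ‖hessianDetFlux u₁ φ t x - hessianDetFlux u₂ φ t x‖ₑ ≤
          ENNReal.ofReal (C * H) *
            ∫⁻ q, ENNReal.ofReal (meanOsc (fderiv ℝ (u₁ - u₂)) q.1 q.2) *
              (ENNReal.ofReal (meanOsc (fderiv ℝ u₁) q.1 q.2) +
                ENNReal.ofReal (meanOsc (fderiv ℝ u₂) q.1 q.2)) ^ (N - 1)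
              ∂scaleMeasure (EuclideanSpace ℝ (Fin N)) (N - 2) := by
  obtain ⟨C, hC0, hC⟩ := exists_abs_hessianDetFlux_sub_le N
  refine ⟨C, hC0, fun u₁ u₂ φ hu₁ hu₁_supp hu₂ hu₂_supp H hH => ?_⟩
  have hmeas {u : EuclideanSpace ℝ (Fin N) → ℝ} (hu : ContDiff ℝ 2 u) :=
    aemeasurable_meanOsc (hu.continuous_fderiv two_ne_zero) (N - 2 : ℝ)
  have hweight {t : ℝ} (ht : 0 < t) : t⁻¹ ^ (N - 1) = t ^ (-1 - (N - 2 : ℝ)) := by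
    rw [inv_pow, ← Real.rpow_natCast, ← Real.rpow_neg ht.le, Nat.cast_pred (Nat.pos_of_ne_zero hN)]
    congr 1
    ring
  have hscale := lintegral_scaleMeasure_left ((hmeas (u := u₁ - u₂) (hu₁.sub hu₂)).mul
    (((hmeas hu₁).add (hmeas hu₂)).pow_const (N - 1)))
  simp only [Pi.mul_apply, Pi.add_apply] at hscale
  rw [hscale, ← lintegral_const_mul' _ _ ENNReal.ofReal_ne_top]
  refine setLIntegral_mono' measurableSet_Ioi fun t ht => ?_
  rw [← lintegral_const_mul' _ _ ENNReal.ofReal_ne_top,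
    ← lintegral_const_mul' _ _ ENNReal.ofReal_ne_top]
  refine lintegral_mono fun x => ?_
  have ho := meanOsc_nonneg (fderiv ℝ (u₁ - u₂)) t x
  have ho₁ := meanOsc_nonneg (fderiv ℝ u₁) t x
  have ho₂ := meanOsc_nonneg (fderiv ℝ u₂) t x
  have hbound := hC u₁ u₂ φ hu₁ hu₁_supp hu₂ hu₂_supp t ht x H fun i j => hH i j x
  rw [hweight ht] at hbound
  rw [Real.enorm_eq_ofReal_abs, ← ENNReal.ofReal_add ho₁ ho₂, ← ENNReal.ofReal_pow (by positivity),
    ← ENNReal.ofReal_mul ho, ← ENNReal.ofReal_mul (Real.rpow_nonneg (le_of_lt ht) _),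
    ← ENNReal.ofReal_mul' (mul_nonneg (Real.rpow_nonneg (le_of_lt ht) _) (by positivity))]
  exact ENNReal.ofReal_le_ofReal hbound

end BesovEstimate

section Finiteness

open Set Module

variable {E : Type*} [NormedAddCommGroup E] [InnerProductSpace ℝ E]
  {G : Type*} [NormedAddCommGroup G] [NormedSpace ℝ G]

theorem exists_norm_sub_rpow_le_mul_min {F : E → G} (hF : ContDiff ℝ 1 F)
    (hF_supp : HasCompactSupport F) {p : ℝ} (hp : 0 ≤ p) :
    ∃ B : ℝ, ∀ x y, ‖F x - F y‖ ^ p ≤ B * min (‖x - y‖ ^ p) 1 := by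
  obtain ⟨L, hL⟩ := hF.lipschitzWith_of_hasCompactSupport hF_supp one_ne_zero
  obtain ⟨M, hM⟩ := hF_supp.exists_bound_of_continuous hF.continuous
  refine ⟨max (L : ℝ) (2 * M) ^ p, fun x y => ?_⟩
  rw [mul_min_of_nonneg _ _ (by positivity), mul_one,
    ← Real.mul_rpow (by positivity) (by positivity)]
  refine le_min ?_ ?_ <;> gcongr
  · calc ‖F x - F y‖ ≤ L * ‖x - y‖ := hL.norm_sub_le x y
      _ ≤ max (L : ℝ) (2 * M) * ‖x - y‖ := by gcongr; exact le_max_left _ _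
  · calc ‖F x - F y‖ ≤ M + M := norm_sub_le_of_le (hM x) (hM y)
      _ ≤ max (L : ℝ) (2 * M) := (two_mul M).symm.trans_le (le_max_right _ _)

variable [FiniteDimensional ℝ E] [MeasurableSpace E] [BorelSpace E]

theorem integrable_min_rpow_one_div_rpow_norm [Nontrivial E] {p q : ℝ} (hq : finrank ℝ E < q)
    (hqp : q < finrank ℝ E + p) : Integrable fun x : E => min (‖x‖ ^ p) 1 / ‖x‖ ^ q := by
  refine (integrable_fun_norm_addHaar volume (f := fun r => min (r ^ p) 1 / r ^ q)).2 ?_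
  have hpred : ((finrank ℝ E - 1 : ℕ) : ℝ) = finrank ℝ E - 1 := Nat.cast_pred finrank_pos
  have hpow {y : ℝ} (hy : 0 < y) (r : ℝ) :
      y ^ (finrank ℝ E - 1) * (y ^ r / y ^ q) = y ^ (finrank ℝ E - 1 + r - q) := by
    rw [← Real.rpow_natCast, hpred, ← Real.rpow_sub hy, ← Real.rpow_add hy, add_sub_assoc]
  rw [← Ioc_union_Ioi_eq_Ioi zero_le_one]
  refine IntegrableOn.union ?_ ?_
  · have h : IntegrableOn (fun y : ℝ => y ^ (finrank ℝ E - 1 + p - q)) (Ioc 0 1) :=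
      (intervalIntegrable_iff_integrableOn_Ioc_of_le zero_le_one).1
        (intervalIntegral.intervalIntegrable_rpow' (by linarith))
    refine h.congr_fun (fun y hy => ?_) measurableSet_Ioc
    beta_reduce
    rw [← hpow hy.1, min_eq_left (Real.rpow_le_one hy.1.le hy.2 (by linarith)), smul_eq_mul]
  · have h : IntegrableOn (fun y : ℝ => y ^ (finrank ℝ E - 1 + 0 - q)) (Ioi 1) :=
      integrableOn_Ioi_rpow_of_lt (by linarith) one_pos
    refine h.congr_fun (fun y hy => ?_) measurableSet_Ioi
    beta_reduce
    rw [← hpow (one_pos.trans hy), Real.rpow_zero,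
      min_eq_right (Real.one_le_rpow (le_of_lt hy) (by linarith)), smul_eq_mul]

theorem lintegral_lintegral_le_of_le_comp_sub {k : E → E → ℝ≥0∞} {Ψ : E → ℝ≥0∞}
    (hΨ : Measurable Ψ) {S : Set E} (hS : MeasurableSet S) (hk : ∀ x y, k x y ≤ Ψ (x - y))
    (hk_zero : ∀ x ∉ S, ∀ y ∉ S, k x y = 0) :
    ∫⁻ x, ∫⁻ y, k x y ≤ 2 * volume S * ∫⁻ z, Ψ z := by
  have hpt (x y : E) :
      k x y ≤ S.indicator 1 x * Ψ (x - y) + S.indicator 1 y * Ψ (x - y) := by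
    by_cases hx : x ∈ S
    · simpa [hx] using (hk x y).trans le_self_add
    by_cases hy : y ∈ S
    · simpa [hx, hy] using hk x y
    · simp [hk_zero x hx y hy]
  have hind : Measurable (S.indicator (1 : E → ℝ≥0∞)) := measurable_one.indicator hS
  have hleft : Measurable fun q : E × E => S.indicator 1 q.1 * Ψ (q.1 - q.2) := by fun_prop
  have hright : Measurable fun q : E × E => S.indicator 1 q.2 * Ψ (q.1 - q.2) := by fun_prop
  have hslice : ∫⁻ x, S.indicator (1 : E → ℝ≥0∞) x * ∫⁻ z, Ψ z = volume S * ∫⁻ z, Ψ z := by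
    rw [lintegral_mul_const _ hind, lintegral_indicator_one hS]
  have hfst : ∫⁻ x, ∫⁻ y, S.indicator 1 x * Ψ (x - y) = volume S * ∫⁻ z, Ψ z := by
    rw [← hslice]
    refine lintegral_congr fun x => ?_
    rw [lintegral_const_mul _ (by fun_prop), lintegral_sub_left_eq_self]
  have hsnd : ∫⁻ x, ∫⁻ y, S.indicator 1 y * Ψ (x - y) = volume S * ∫⁻ z, Ψ z := by
    rw [lintegral_lintegral_swap (f := fun x y => S.indicator 1 y * Ψ (x - y))
      hright.aemeasurable, ← hslice]
    refine lintegral_congr fun y => ?_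
    rw [lintegral_const_mul _ (by fun_prop), lintegral_sub_right_eq_self]
  calc ∫⁻ x, ∫⁻ y, k x y
      ≤ ∫⁻ x, ∫⁻ y, (S.indicator 1 x * Ψ (x - y) + S.indicator 1 y * Ψ (x - y)) :=
        lintegral_mono fun x => lintegral_mono fun y => hpt x y
    _ = ∫⁻ x, ((∫⁻ y, S.indicator 1 x * Ψ (x - y)) + ∫⁻ y, S.indicator 1 y * Ψ (x - y)) :=
        lintegral_congr fun x => lintegral_add_left (hleft.comp measurable_prodMk_left) _
    _ = 2 * volume S * ∫⁻ z, Ψ z := by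
        rw [lintegral_add_left hleft.lintegral_prod_right', hfst, hsnd, mul_assoc, two_mul]

theorem lintegral_lintegral_norm_sub_rpow_div_lt_top [Nontrivial E] {F : E → G}
    (hF : ContDiff ℝ 1 F) (hF_supp : HasCompactSupport F) {p q : ℝ} (hq : finrank ℝ E < q)
    (hqp : q < finrank ℝ E + p) :
    ∫⁻ x, ∫⁻ y, ENNReal.ofReal (‖F x - F y‖ ^ p / ‖x - y‖ ^ q) < ∞ := by
  have hp : 0 < p := by linarith
  obtain ⟨B, hB⟩ := exists_norm_sub_rpow_le_mul_min hF hF_supp hp.le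
  set ψ : E → ℝ := fun z => B * (min (‖z‖ ^ p) 1 / ‖z‖ ^ q)
  have hψ : Integrable ψ := (integrable_min_rpow_one_div_rpow_norm hq hqp).const_mul B
  have hψ_meas : Measurable fun z => ENNReal.ofReal (ψ z) := by fun_prop
  refine (lintegral_lintegral_le_of_le_comp_sub hψ_meas (isClosed_tsupport F).measurableSet
    (fun x y => ENNReal.ofReal_le_ofReal ?_) fun x hx y hy => ?_).trans_lt
    (ENNReal.mul_lt_top (ENNReal.mul_lt_top ENNReal.ofNat_lt_top hF_supp.measure_lt_top)
      hψ.lintegral_lt_top)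
  · simp only [ψ, ← mul_div_assoc]
    gcongr
    exact hB x y
  · simp [image_eq_zero_of_notMem_tsupport hx, image_eq_zero_of_notMem_tsupport hy,
      Real.zero_rpow hp.ne']

variable {N : ℕ} {u : EuclideanSpace ℝ (Fin N) → ℝ}

theorem besovENorm_ne_top (hN : N ≠ 0) (hu : ContDiff ℝ 2 u) (hu_supp : HasCompactSupport u)
    {s p : ℝ} (hp : 0 < p) (hs : 1 < s) (hs' : s < 2) : besovENorm s p u ≠ ∞ := by
  have : NeZero N := ⟨hN⟩
  have hDu : ContDiff ℝ 1 (fderiv ℝ u) := hu.fderiv_right (by norm_num)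
  have hDu_supp : HasCompactSupport (fderiv ℝ u) := hu_supp.fderiv ℝ
  refine ENNReal.add_ne_top.2 ⟨ENNReal.add_ne_top.2 ⟨?_, ?_⟩, ?_⟩
  · exact (hu.continuous.memLp_of_hasCompactSupport hu_supp).2.ne
  · exact (hDu.continuous.memLp_of_hasCompactSupport hDu_supp).2.ne
  · refine ENNReal.rpow_ne_top_of_nonneg (by positivity)
      (lintegral_lintegral_norm_sub_rpow_div_lt_top hDu hDu_supp ?_ ?_).ne <;>
      rw [finrank_euclideanSpace_fin] <;> nlinarith

theorem norm_le_toReal_eLpNorm_top {X F : Type*} [TopologicalSpace X] [MeasurableSpace X]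
    {μ : Measure X} [μ.IsOpenPosMeasure] [NormedAddCommGroup F] {f : X → F} (hf : Continuous f)
    (hfin : eLpNorm f ∞ μ ≠ ∞) (x : X) : ‖f x‖ ≤ (eLpNorm f ∞ μ).toReal := by
  have hae : ∀ᵐ y ∂μ, ‖f y‖ ≤ (eLpNorm f ∞ μ).toReal := by
    rw [eLpNorm_exponent_top] at hfin ⊢
    filter_upwards [ae_le_eLpNormEssSup (f := f) (μ := μ)] with y hy
    simpa using ENNReal.toReal_mono hfin hy
  have hclosed : IsClosed {y | ‖f y‖ ≤ (eLpNorm f ∞ μ).toReal} :=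
    isClosed_le hf.norm continuous_const
  exact hclosed.closure_subset (Measure.dense_of_ae hae x)

theorem norm_fderiv_le_toReal_eLpNorm_top {F : E → G} (hF : ContDiff ℝ 1 F)
    (hF_supp : HasCompactSupport F) (x : E) :
    ‖fderiv ℝ F x‖ ≤ (eLpNorm (fderiv ℝ F) ∞ volume).toReal :=
  have hDF : Continuous (fderiv ℝ F) := hF.continuous_fderiv one_ne_zero
  norm_le_toReal_eLpNorm_top hDF (hDF.memLp_of_hasCompactSupport (hF_supp.fderiv ℝ)).2.ne x

theorem abs_hessianMatrix_le_hessianSupNorm (hu : ContDiff ℝ 2 u) (hu_supp : HasCompactSupport u)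
    (i j : Fin N) (x : EuclideanSpace ℝ (Fin N)) : |hessianMatrix u x i j| ≤ hessianSupNorm u :=
  (abs_hessianMatrix_le_norm u x i j).trans <|
    norm_fderiv_le_toReal_eLpNorm_top (hu.fderiv_right (by norm_num)) (hu_supp.fderiv ℝ) x

end Finiteness

section Main

variable {N : ℕ} {u : EuclideanSpace ℝ (Fin N) → ℝ}

theorem gagliardoESeminormDeriv_le_besovENorm (s p : ℝ) :
    gagliardoESeminormDeriv (s - 1) p u ≤ besovENorm s p u :=
  le_add_self

theorem exists_enorm_integral_det_sub_det_mul_le (hN : 2 ≤ N) :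
    ∃ C : ℝ, 0 ≤ C ∧ ∀ u₁ u₂ φ : EuclideanSpace ℝ (Fin N) → ℝ,
      ContDiff ℝ 2 u₁ → HasCompactSupport u₁ → ContDiff ℝ 2 u₂ → HasCompactSupport u₂ →
      ContDiff ℝ 2 φ → HasCompactSupport φ →
      ‖∫ x, ((hessianMatrix u₁ x).det - (hessianMatrix u₂ x).det) * φ x‖ₑ ≤
        ENNReal.ofReal (C * hessianSupNorm φ) *
          (besovENorm (2 - 2 / (N : ℝ)) N (u₁ - u₂) *
            (besovENorm (2 - 2 / (N : ℝ)) N u₁ + besovENorm (2 - 2 / (N : ℝ)) N u₂) ^ (N - 1)) := by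
  have hN_ne : N ≠ 0 := by omega
  have hN_two : (2 : ℝ) ≤ N := by exact_mod_cast hN
  have hσ : (2 - 2 / (N : ℝ) - 1) * N = N - 2 := by field_simp; ring
  obtain ⟨C, hC, hflux⟩ := exists_lintegral_enorm_hessianDetFlux_sub_le hN_ne
  set V : ℝ := (volume.real (Metric.closedBall (0 : EuclideanSpace ℝ (Fin N)) 1) *
    (N + (N - 2)))⁻¹ with hV
  have hV_nonneg : 0 ≤ V := inv_nonneg.2 (mul_nonneg measureReal_nonneg (by linarith))
  refine ⟨C * V, mul_nonneg hC hV_nonneg, fun u₁ u₂ φ hu₁ hu₁_supp hu₂ hu₂_supp hφ hφ_supp => ?_⟩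
  have hosc := lintegral_meanOsc_fderiv_mul_pow_le hN_ne (hu₁.of_le one_le_two)
    (hu₂.of_le one_le_two) (σ := 2 - 2 / (N : ℝ) - 1) (by rw [hσ]; linarith)
  rw [hσ, ← hV] at hosc
  have hH : 0 ≤ hessianSupNorm φ := ENNReal.toReal_nonneg
  refine (enorm_integral_det_sub_det_mul_le hN_ne hu₁ hu₁_supp hu₂ hu₂_supp hφ hφ_supp).trans <|
    (hflux u₁ u₂ φ hu₁ hu₁_supp hu₂ hu₂_supp _
      (abs_hessianMatrix_le_hessianSupNorm hφ hφ_supp)).trans ?_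
  rw [mul_right_comm, ENNReal.ofReal_mul (mul_nonneg hC hH), mul_assoc]
  refine mul_le_mul_right (hosc.trans ?_) _
  gcongr <;> exact gagliardoESeminormDeriv_le_besovENorm _ _

theorem toReal_mul_mul_add_pow_le {a b c : ℝ≥0∞} (ha : a ≠ ∞) (hb : b ≠ ∞) {A : ℝ} (hA : 0 ≤ A)
    (n : ℕ) : (ENNReal.ofReal A * (c * (a + b) ^ n)).toReal ≤
      2 ^ (n - 1) * A * c.toReal * (a.toReal ^ n + b.toReal ^ n) := by
  rw [ENNReal.toReal_mul, ENNReal.toReal_mul, ENNReal.toReal_pow, ENNReal.toReal_add ha hb,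
    ENNReal.toReal_ofReal hA]
  calc A * (c.toReal * (a.toReal + b.toReal) ^ n)
      ≤ A * (c.toReal * (2 ^ (n - 1) * (a.toReal ^ n + b.toReal ^ n))) := by
        gcongr
        exact add_pow_le ENNReal.toReal_nonneg ENNReal.toReal_nonneg n
    _ = 2 ^ (n - 1) * A * c.toReal * (a.toReal ^ n + b.toReal ^ n) := by ring

end Main

theorem theorem1 (N : ℕ) (hN : 3 ≤ N) :
    ∃ C : ℝ, 0 < C ∧
      ∀ u₁ u₂ φ : EuclideanSpace ℝ (Fin N) → ℝ,
        ContDiff ℝ 2 u₁ → HasCompactSupport u₁ →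
        ContDiff ℝ 2 u₂ → HasCompactSupport u₂ →
        ContDiff ℝ 2 φ → HasCompactSupport φ →
        |∫ x, ((hessianMatrix u₁ x).det - (hessianMatrix u₂ x).det) * φ x| ≤
          C * besovNorm (2 - 2 / (N : ℝ)) N (u₁ - u₂) *
            (besovNorm (2 - 2 / (N : ℝ)) N u₁ ^ (N - 1) +
              besovNorm (2 - 2 / (N : ℝ)) N u₂ ^ (N - 1)) *
            hessianSupNorm φ := by
  obtain ⟨C, hC, hdet⟩ := exists_enorm_integral_det_sub_det_mul_le (Nat.le_of_succ_le hN)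
  refine ⟨2 ^ (N - 1 - 1) * (C + 1), by positivity,
    fun u₁ u₂ φ hu₁ hu₁_supp hu₂ hu₂_supp hφ hφ_supp => ?_⟩
  have hN_three : (3 : ℝ) ≤ N := by exact_mod_cast hN
  have hfrac : 0 < 2 / (N : ℝ) ∧ 2 / (N : ℝ) < 1 :=
    ⟨by positivity, (div_lt_one (by positivity)).2 (by linarith)⟩
  have hfin {u : EuclideanSpace ℝ (Fin N) → ℝ} (hu : ContDiff ℝ 2 u)
      (hu_supp : HasCompactSupport u) : besovENorm (2 - 2 / (N : ℝ)) N u ≠ ∞ :=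
    besovENorm_ne_top (by omega) hu hu_supp (by positivity) (by linarith) (by linarith)
  have hH : 0 ≤ hessianSupNorm φ := ENNReal.toReal_nonneg
  have hw := hfin (hu₁.sub hu₂) (hu₁_supp.sub hu₂_supp)
  have h₁ := hfin hu₁ hu₁_supp
  have h₂ := hfin hu₂ hu₂_supp
  have hreal := (ENNReal.toReal_mono (by finiteness)
    (hdet u₁ u₂ φ hu₁ hu₁_supp hu₂ hu₂_supp hφ hφ_supp)).trans
    (toReal_mul_mul_add_pow_le h₁ h₂ (mul_nonneg hC hH) (N - 1))
  rw [toReal_enorm, Real.norm_eq_abs] at hreal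
  calc _ ≤ _ := hreal
    _ ≤ 2 ^ (N - 1 - 1) * ((C + 1) * hessianSupNorm φ) * _ * _ := by
      gcongr; linarith
    _ = _ := by unfold besovNorm; ring
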